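/- For integers $q\ge 0$ and $n\ge 1$, the $(1:q)$ Client-Waiter game on $E(K_n)$ is played in rounds on the edge set of the complete graph $K_n$. In each round Waiter offers Client a set of at least $1$ and at most $q+1$ edges that have not been offered before; Client chooses exactly one of them, which he claims, and the other offered edges are claimed by Waiter. The game ends when all edges have been claimed. At any moment, Client's graph is the graph on $V(K_n)$ whose edges are those claimed by Client so far. For an integer $t\ge 1$, a graph $G$ admits a $K_t$-minor if there are pairwise disjoint sets $B_1,\dots,B_t\subseteq V(G)$ such that each $G[B_i]$ is connected (and non-empty) and, for all $i<j$, $G$ has an edge between $B_i$ and $B_j$; otherwise it is $K_t$-minor free. (A graph is $K_3$-minor free if and only if it is a forest.) **Theorem 1.3.** There exist an absolute constant $c>0$ and an integer $n_0$ such that the following hold for every integer $n\ge n_0$. 1. For every integer $q\ge n/2-1$, Waiter has a strategy in the $(1:q)$ Client-Waiter game on $E(K_n)$ that keeps Client's graph $K_3$-minor free throughout the game. 2. For every real $\varepsilon>0$ (which may depend on $n$) and every integer $q$ with $0\le q\le (1/2-\varepsilon)n$, Client has a strategy in the $(1:q)$ Client-Waiter game on $E(K_n)$ that ensures that, at the end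 of the game, Client's graph admits a $K_t$-minor with $t=\left\lceil(\varepsilon n)^{c\varepsilon}\right\rceil$. -/

import Mathlib

namespace ClientWaiter

/-- One round of a (1 : q) Client-Waiter game: the set of board elements which Waiter offers and
the element of it which Client keeps. The other offered elements are claimed by Waiter. -/
structure Round (α : Type*) where
  offer : Finset α
  pick : α

/-- The rounds played so far, the most recent one first. -/
abbrev History (α : Type*) := List (Round α)

variable {α : Type*} [DecidableEq α]

/-- The board elements that have been offered, that is, claimed by one of the two players. -/
def offered : History α → Finset α
  | [] => ∅
  | r :: h => r.offer ∪ offered h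

/-- The board elements that have been claimed by Client. -/
def clientSet : History α → Finset α
  | [] => ∅
  | r :: h => insert r.pick (clientSet h)

/-- The elements of the board `X` that have not been claimed yet. -/
def free (X : Finset α) (h : History α) : Finset α := X \ offered h

/-- After the rounds `h`, Waiter may offer any set of free elements with at least 1 and
at most `q + 1` members. -/
def LegalOffer (q : ℕ) (X : Finset α) (h : History α) (O : Finset α) : Prop :=
  O.Nonempty ∧ O.card ≤ q + 1 ∧ O ⊆ free X h

/-- `IsPlay q X h`: the rounds `h` form a legal (perhaps unfinished) play of the (1 : q)
Client-Waiter game on the board `X`. -/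
inductive IsPlay (q : ℕ) (X : Finset α) : History α → Prop
  | start : IsPlay q X []
  | round {h : History α} {O : Finset α} {x : α} :
      IsPlay q X h → LegalOffer q X h O → x ∈ O → IsPlay q X (⟨O, x⟩ :: h)

/-- A strategy of Waiter for the (1 : q) game on `X` tells him, as long as there are free
elements, which legal offer to make; it may depend on the whole history. -/
def IsWaiterStrategy (q : ℕ) (X : Finset α) (S : History α → Finset α) : Prop :=
  ∀ h, IsPlay q X h → (free X h).Nonempty → LegalOffer q X h (S h)

/-- A strategy of Client for the (1 : q) game on `X` tells him which element of the current
offer to keep; it may depend on the whole history. -/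
def IsClientStrategy (q : ℕ) (X : Finset α) (T : History α → Finset α → α) : Prop :=
  ∀ h O, IsPlay q X h → LegalOffer q X h O → T h O ∈ O

/-- In all the rounds of `h`, Waiter followed `S`. -/
def FollowsWaiter (S : History α → Finset α) : History α → Prop
  | [] => True
  | r :: h => r.offer = S h ∧ FollowsWaiter S h

/-- In all the rounds of `h`, Client followed `T`. -/
def FollowsClient (T : History α → Finset α → α) : History α → Prop
  | [] => True
  | r :: h => r.pick = T h r.offer ∧ FollowsClient T h

/-- In the (1 : q) Client-Waiter game on `X`, Waiter has a strategy which ensures that the set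
of elements claimed by Client satisfies `P` throughout the game. -/
def WaiterCanKeep (q : ℕ) (X : Finset α) (P : Finset α → Prop) : Prop :=
  ∃ S : History α → Finset α, IsWaiterStrategy q X S ∧
    ∀ h, IsPlay q X h → FollowsWaiter S h → P (clientSet h)

/-- In the (1 : q) Client-Waiter game on `X`, Client has a strategy which ensures that, when all
elements of `X` have been claimed, the set of elements claimed by him satisfies `P`. -/
def ClientCanBuild (q : ℕ) (X : Finset α) (P : Finset α → Prop) : Prop :=
  ∃ T : History α → Finset α → α, IsClientStrategy q X T ∧
    ∀ h, IsPlay q X h → FollowsClient T h → free X h = ∅ → P (clientSet h)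

/-- `G` admits a `K_t`-minor: there are `t` pairwise disjoint vertex sets that induce connected
(so nonempty) subgraphs of `G`, with an edge of `G` between any two of them. -/
def HasCliqueMinor {V : Type*} (G : SimpleGraph V) (t : ℕ) : Prop :=
  ∃ B : Fin t → Set V,
    (∀ i, (G.induce (B i)).Connected) ∧
    (∀ i j, i ≠ j → Disjoint (B i) (B j)) ∧
    (∀ i j, i ≠ j → ∃ u ∈ B i, ∃ v ∈ B j, G.Adj u v)

/-- The edge set of the complete graph on `n` vertices. -/
def completeBoard (n : ℕ) : Finset (Sym2 (Fin n)) := (⊤ : SimpleGraph (Fin n)).edgeFinset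

/-- The graph on `n` vertices with edge set `E`. -/
def graphOf {n : ℕ} (E : Finset (Sym2 (Fin n))) : SimpleGraph (Fin n) :=
  SimpleGraph.fromEdgeSet (E : Set (Sym2 (Fin n)))

end ClientWaiter

/-! Waiter (part 1) grows one tree on a vertex set `C`, all of whose inner edges have been offered.
A vertex outside `C` carries a bundle of free edges to `C`; its size is the weight of the vertex.
Offering the whole bundles of a set `Y` makes Client attach some `y ∈ Y` as a leaf. The other
bundles of `Y` shrink to their edge to `y`; the bundles outside `Y` grow by one. It remains to find,
in every round, a nonempty `Y` of total weight at most `m = q + 1`, starting from at most `2m - 1`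
unit weights: `SafeWeights.step`.

Client (part 2) imitates a random graph of density `p = 2(1 + ε)/n`, for which `p(q + 1) ≤ 1`. He
never lets the expected number of edges minus the expected number of short cycles decrease
(`clientCanBuild_of_expectation`). Deleting an edge of every short cycle then leaves about `(1 +
ε)n` edges and girth of logarithmic order (`clientCanBuild_of_highGirth`).

Such a graph has a subgraph in which removing any vertices removes at least `1 + δ` edges per
vertex. By the girth its small balls are trees, so they grow by a factor `1 + δ` per step. Cutting
it into breadth-first trees around a maximal packing of balls of radius `r`, and contracting these
trees, creates no loops or parallel edges and gives average degree at least `2(1 + δ)^r`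
(`CriticallyDense.exists_branchFamily`).

Finally, average degree of order `t²` forces a `K_t`-minor (`hasCliqueMinor_of_branchFamily`): in a
densest contraction the neighbourhood of a vertex of at most average degree is so dense that `t` of
its vertices can be joined pairwise through distinct common neighbours. With `r` of order `log
(εn)`, this allows `t` to be a power of `εn` with exponent of order `ε`. -/

namespace ClientWaiter

/-! ### Strategies from invariants of the position -/

section Strategies

variable {α : Type*} [DecidableEq α]

lemma offered_subset_of_isPlay {q : ℕ} {X : Finset α} {h : History α} (hp : IsPlay q X h) :
    offered h ⊆ X := by
  induction hp with
  | start => simp [offered]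
  | round _ hO _ ih =>
    exact Finset.union_subset (hO.2.2.trans Finset.sdiff_subset) ih

lemma clientSet_subset_offered {q : ℕ} {X : Finset α} {h : History α} (hp : IsPlay q X h) :
    clientSet h ⊆ offered h := by
  induction hp with
  | start => simp [offered, clientSet]
  | round _ _ hx ih =>
    exact Finset.insert_subset (Finset.mem_union_left _ hx) (ih.trans Finset.subset_union_right)

/-- Waiter keeps `P` if he can keep an invariant of the position, given by the set of offered
elements and Client's set, that implies `P`. -/
theorem waiterCanKeep_of_invariant {q : ℕ} {X : Finset α} {P : Finset α → Prop}
    (Inv : Finset α → Finset α → Prop) (hstart : Inv ∅ ∅) (hP : ∀ D E, Inv D E → P E)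
    (hstep : ∀ D E, Inv D E → (X \ D).Nonempty →
      ∃ O : Finset α, O.Nonempty ∧ O.card ≤ q + 1 ∧ O ⊆ X \ D ∧
        ∀ x ∈ O, Inv (O ∪ D) (insert x E)) :
    WaiterCanKeep q X P := by
  classical
  have key : ∀ h : History α, ∃ O : Finset α, ((free X h).Nonempty → LegalOffer q X h O) ∧
      ((free X h).Nonempty → Inv (offered h) (clientSet h) →
        ∀ x ∈ O, Inv (O ∪ offered h) (insert x (clientSet h))) := by
    intro h
    by_cases hf : (free X h).Nonempty
    · by_cases hi : Inv (offered h) (clientSet h)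
      · obtain ⟨O, h1, h2, h3, h4⟩ := hstep _ _ hi hf
        exact ⟨O, fun _ => ⟨h1, h2, h3⟩, fun _ _ => h4⟩
      · obtain ⟨x, hx⟩ := hf
        exact ⟨{x}, fun _ => ⟨by simp, by simp, by simpa using hx⟩, fun _ h => absurd h hi⟩
    · exact ⟨∅, fun h => absurd h hf, fun h => absurd h hf⟩
  choose S hS hS' using key
  refine ⟨S, fun h _ hf => hS h hf, ?_⟩
  have main : ∀ h, IsPlay q X h → FollowsWaiter S h → Inv (offered h) (clientSet h) := by
    intro h hp
    induction hp with
    | start => intro _; exact hstart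
    | round hp hO hx ih =>
      rintro ⟨rfl, hF⟩
      exact hS' _ (hO.1.mono hO.2.2) (ih hF) _ hx
  exact fun h hp hF => hP _ _ (main h hp hF)

/-- Client builds `P` if he can keep an invariant of the position, given by the set of offered
elements and his set, that implies `P` at the end of the game. -/
theorem clientCanBuild_of_invariant {q : ℕ} {X : Finset α} {P : Finset α → Prop}
    (Inv : Finset α → Finset α → Prop) (hX : X.Nonempty) (hstart : Inv ∅ ∅)
    (hP : ∀ E, E ⊆ X → E.Nonempty → Inv X E → P E)
    (hstep : ∀ D E O, Inv D E → O.Nonempty → O.card ≤ q + 1 → O ⊆ X \ D →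
      ∃ x ∈ O, Inv (O ∪ D) (insert x E)) :
    ClientCanBuild q X P := by
  classical
  have key : ∀ (h : History α) (O : Finset α), ∃ x : α, LegalOffer q X h O →
      x ∈ O ∧ (Inv (offered h) (clientSet h) → Inv (O ∪ offered h) (insert x (clientSet h))) := by
    intro h O
    by_cases hO : LegalOffer q X h O
    · by_cases hi : Inv (offered h) (clientSet h)
      · obtain ⟨x, hx, hx'⟩ := hstep _ _ O hi hO.1 hO.2.1 hO.2.2
        exact ⟨x, fun _ => ⟨hx, fun _ => hx'⟩⟩
      · obtain ⟨x, hx⟩ := hO.1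
        exact ⟨x, fun _ => ⟨hx, fun h => absurd h hi⟩⟩
    · exact ⟨hX.choose, fun h => absurd h hO⟩
  choose T hT using key
  refine ⟨T, fun h O _ hO => (hT h O hO).1, ?_⟩
  have main : ∀ h, IsPlay q X h → FollowsClient T h → Inv (offered h) (clientSet h) := by
    intro h hp
    induction hp with
    | start => intro _; exact hstart
    | round hp hO hx ih =>
      rintro ⟨hx, hF⟩
      have := (hT _ _ hO).2 (ih hF)
      rwa [← show _ = T _ _ from hx] at this
  intro h hp hF hfree
  have hDX : offered h = X :=
    (offered_subset_of_isPlay hp).antisymm (Finset.sdiff_eq_empty_iff_subset.mp hfree)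
  refine hP _ ((clientSet_subset_offered hp).trans hDX.le) ?_ (hDX ▸ main h hp hF)
  cases h with
  | nil => exact absurd hDX.symm hX.ne_empty
  | cons r h => exact Finset.insert_nonempty _ _

end Strategies

/-! ### The weight game behind Waiter's strategy -/

section Weights

variable {V : Type*} [DecidableEq V]

/-- All weights are one, and there are at most `2m - 1` vertices. -/
def InitialWeights (m : ℕ) (S : Finset V) (w : V → ℕ) : Prop :=
  S.card + 1 ≤ 2 * m ∧ ∀ z ∈ S, w z = 1

/-- At most `m - i` weights equal to one, at most `m - i` weights of at most `i + 1`, and other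
weights bounded by distinct numbers from `2, …, i`. -/
def GrowingWeights (m i : ℕ) (S : Finset V) (w : V → ℕ) : Prop :=
  ∃ (L T : Finset V) (l : V → ℕ), L ⊆ S ∧ T ⊆ S ∧ Disjoint L T ∧ L.card + i ≤ m ∧
    T.card + i ≤ m ∧ (∀ z ∈ L, w z = 1) ∧ (∀ z ∈ T, w z ≤ i + 1) ∧
    (∀ z ∈ S, z ∉ L → z ∉ T → w z ≤ l z ∧ 2 ≤ l z ∧ l z ≤ i) ∧
    (∀ y ∈ S, ∀ z ∈ S, y ∉ L → y ∉ T → z ∉ L → z ∉ T → l y = l z → y = z)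

/-- The weights are bounded by distinct numbers up to `m`. -/
def StaircaseWeights (m : ℕ) (S : Finset V) (w : V → ℕ) : Prop :=
  ∃ l : V → ℕ, Set.InjOn l S ∧ ∀ z ∈ S, w z ≤ l z ∧ l z ≤ m

/-- The weights with which Waiter can go on merging vertices into his growing component. -/
def SafeWeights (m : ℕ) (S : Finset V) (w : V → ℕ) : Prop :=
  InitialWeights m S w ∨ (∃ i, 1 ≤ i ∧ GrowingWeights m i S w) ∨ StaircaseWeights m S w

/-- The weights after a round in which the bundles of `Y` have been offered. -/
def nextWeights (Y : Finset V) (w : V → ℕ) (z : V) : ℕ := if z ∈ Y then 1 else w z + 1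

/-- Offering `m` unit bundles, or all if there are fewer, leaves at most `m - 1` vertices of weight
one and at most `m - 1` of weight two: the growing stage with `i = 1`. -/
lemma InitialWeights.step {m : ℕ} {S : Finset V} {w : V → ℕ} (h : InitialWeights m S w)
    (hS : S.Nonempty) : ∃ Y ⊆ S, Y.Nonempty ∧ ∑ z ∈ Y, w z ≤ m ∧
      ∀ y ∈ Y, SafeWeights m (S.erase y) (nextWeights Y w) := by
  obtain ⟨hc, hw⟩ := h
  have hS1 := hS.card_pos
  obtain ⟨Y, hYS, hY⟩ := Finset.exists_subset_card_eq (min_le_right m S.card)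
  refine ⟨Y, hYS, Finset.card_pos.mp (by omega), ?_, fun y hy => .inr (.inl ⟨1, le_rfl, ?_⟩)⟩
  · rw [Finset.sum_congr rfl fun z hz => hw z (hYS hz)]
    simp only [Finset.sum_const, smul_eq_mul]; omega
  · have h1 := Finset.card_erase_of_mem hy
    have h2 := Finset.card_sdiff_of_subset hYS
    refine ⟨Y.erase y, S \ Y, fun _ => 2, Finset.erase_subset_erase _ hYS, ?_, ?_, by omega,
      by omega, ?_, ?_, ?_, ?_⟩
    · intro z hz
      rw [Finset.mem_sdiff] at hz
      exact Finset.mem_erase.mpr ⟨fun h => hz.2 (h ▸ hy), hz.1⟩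
    · exact Finset.disjoint_sdiff.mono_left (Finset.erase_subset _ _)
    · intro z hz; simp [nextWeights, Finset.mem_of_mem_erase hz]
    · intro z hz
      rw [Finset.mem_sdiff] at hz
      simp [nextWeights, hz.2, hw z hz.1]
    · intro z hz h1 h2; grind
    · intro y' hy' z hz; grind

/-- It suffices to offer a single vertex with the largest bound: all other bounds are strictly
smaller, so they can be raised by one without exceeding `m`. -/
lemma StaircaseWeights.step {m : ℕ} {S : Finset V} {w : V → ℕ} (h : StaircaseWeights m S w)
    (hS : S.Nonempty) : ∃ Y ⊆ S, Y.Nonempty ∧ ∑ z ∈ Y, w z ≤ m ∧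
      ∀ y ∈ Y, SafeWeights m (S.erase y) (nextWeights Y w) := by
  obtain ⟨l, hl, hw⟩ := h
  obtain ⟨y, hy, hmax⟩ := S.exists_max_image l hS
  refine ⟨{y}, by simpa using hy, by simp, by simpa using (hw y hy).1.trans (hw y hy).2, ?_⟩
  intro y' hy'
  obtain rfl := Finset.mem_singleton.mp hy'
  refine .inr (.inr ⟨fun z => l z + 1, ?_, ?_⟩)
  · intro a ha b hb hab
    exact hl (Finset.mem_of_mem_erase ha) (Finset.mem_of_mem_erase hb) (by simpa using hab)
  · intro z hz
    obtain ⟨hne, hzS⟩ := Finset.mem_erase.mp hz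
    have h1 := hmax z hzS
    have h2 : l z ≠ l y' := fun h => hne (hl hzS hy h)
    have h3 := hw z hzS
    have h4 := hw y' hy
    simp only [nextWeights, Finset.mem_singleton, hne, if_false]
    omega

/-- Offer one vertex of `T` and all but one of `L`, at a cost of at most `(i + 1) + (m - i - 1) =
m`. The offered vertices other than `y` form the new `L`, the rest of `T` is the new `T`, and the
vertex left out of `L` gets the bound `2`, vacant because the old bounds `2, …, i` all move up by
one. -/
lemma GrowingWeights.step {m i : ℕ} {S : Finset V} {w : V → ℕ} (hi : 1 ≤ i)
    (h : GrowingWeights m i S w) (hS : S.Nonempty) :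
    ∃ Y ⊆ S, Y.Nonempty ∧ ∑ z ∈ Y, w z ≤ m ∧
      ∀ y ∈ Y, SafeWeights m (S.erase y) (nextWeights Y w) := by
  obtain ⟨L, T, l, hLS, hTS, hLT, hL, hT, hwL, hwT, hwM, hinj⟩ := h
  -- With no `T` and at most one unit weight, the bounds `1, 2, …, i` already form a staircase.
  by_cases hsmall : T = ∅ ∧ L.card ≤ 1
  · refine StaircaseWeights.step ⟨fun z => if z ∈ L then 1 else l z, ?_, ?_⟩ hS
    · intro a ha b hb hab
      obtain ⟨rfl, hL1⟩ := hsmall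
      rw [Finset.card_le_one] at hL1
      have := hwM a ha
      have := hwM b hb
      have := hinj a ha b hb
      grind
    · intro z hz
      obtain ⟨rfl, hL1⟩ := hsmall
      have := hwM z hz
      by_cases hzL : z ∈ L
      · have := Finset.card_pos.mpr ⟨z, hzL⟩
        have := hwL z hzL
        simp only [hzL, if_true]
        omega
      · simp only [hzL, if_false]
        grind
  obtain ⟨T₀, hT₀, hT₀c, hT₁⟩ : ∃ T₀ ⊆ T, T₀.card ≤ 1 ∧ (T \ T₀).card + (i + 1) ≤ m ∧
      (T.Nonempty → T₀.Nonempty) := by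
    rcases T.eq_empty_or_nonempty with rfl | ⟨t, ht⟩
    · refine ⟨∅, by simp, by simp, ?_⟩
      -- If `T` is exhausted, `i + 1 ≤ m` has to come from the two vertices still in `L`.
      have : ¬ L.card ≤ 1 := fun h => hsmall ⟨rfl, h⟩
      simp only [Finset.sdiff_empty, Finset.card_empty]
      refine ⟨by omega, fun h => absurd h (by simp)⟩
    · refine ⟨{t}, by simpa using ht, by simp, ?_, fun _ => by simp⟩
      rw [Finset.card_sdiff_of_subset (by simpa using ht), Finset.card_singleton]
      have := Finset.card_pos.mpr ⟨t, ht⟩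
      omega
  obtain ⟨L₁, hL₁, hL₁c, hL₀, hL₁'⟩ : ∃ L₁ ⊆ L, L₁.card + (i + 1) ≤ m ∧ (L \ L₁).card ≤ 1 ∧
      (2 ≤ L.card → L₁.Nonempty) := by
    rcases L.eq_empty_or_nonempty with rfl | ⟨a, ha⟩
    · refine ⟨∅, by simp, ?_, by simp, by simp⟩
      simp only [Finset.card_empty]
      omega
    · refine ⟨L.erase a, Finset.erase_subset _ _, ?_, ?_, ?_⟩
      · have := Finset.card_erase_add_one ha
        omega
      · rw [Finset.card_sdiff_of_subset (Finset.erase_subset _ _)]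
        have := Finset.card_erase_add_one ha
        omega
      · intro h
        have := Finset.card_erase_add_one ha
        exact Finset.card_pos.mp (by omega)
  have hdisj : Disjoint T₀ L₁ := (hLT.symm.mono_left hT₀).mono_right hL₁
  have hYc := Finset.card_union_of_disjoint hdisj
  refine ⟨T₀ ∪ L₁, Finset.union_subset (hT₀.trans hTS) (hL₁.trans hLS), ?_, ?_, ?_⟩
  · by_cases hT' : T = ∅
    · exact (hL₁' (by by_contra h; exact hsmall ⟨hT', by omega⟩)).mono Finset.subset_union_right
    · exact (hT₁.2 (Finset.nonempty_iff_ne_empty.mpr hT')).mono Finset.subset_union_left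
  · rw [Finset.sum_union hdisj]
    have h1 : ∑ z ∈ T₀, w z ≤ T₀.card * (i + 1) := by
      simpa using Finset.sum_le_card_nsmul T₀ w (i + 1) fun z hz => hwT z (hT₀ hz)
    have h2 : ∑ z ∈ L₁, w z ≤ L₁.card * 1 := by
      simpa using Finset.sum_le_card_nsmul L₁ w 1 fun z hz => (hwL z (hL₁ hz)).le
    have h3 : T₀.card * (i + 1) ≤ 1 * (i + 1) := Nat.mul_le_mul_right _ hT₀c
    omega
  · intro y hy
    have hyc := Finset.card_erase_add_one hy
    refine .inr (.inl ⟨i + 1, by omega, (T₀ ∪ L₁).erase y, T \ T₀,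
      fun z => if z ∈ L then 2 else l z + 1, ?_, ?_, ?_, by omega, hT₁.1, ?_, ?_, ?_, ?_⟩)
    · exact Finset.erase_subset_erase _ (Finset.union_subset (hT₀.trans hTS) (hL₁.trans hLS))
    · intro z hz
      rw [Finset.disjoint_left] at hLT
      have := hTS (Finset.mem_sdiff.mp hz).1
      grind
    · rw [Finset.disjoint_left] at hLT ⊢
      grind
    · intro z hz
      simp [nextWeights, -Finset.mem_union, Finset.mem_of_mem_erase hz]
    · intro z hz
      rw [Finset.disjoint_left] at hLT
      have := hwT z
      have : z ∉ T₀ ∪ L₁ := by grind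
      simp only [nextWeights, this, if_false]
      grind
    · intro z hz h1 h2
      have hzY : z ∉ T₀ ∪ L₁ := by grind
      have := hwM z
      have := hwL z
      simp only [nextWeights, hzY, if_false]
      grind
    · intro a ha b hb ha1 ha2 hb1 hb2 hab
      rw [Finset.card_le_one] at hL₀
      have haL : a ∈ L → a ∈ L \ L₁ := by
        clear hwM hinj hL₀ hwL hwT hT₁; grind
      have hbL : b ∈ L → b ∈ L \ L₁ := by
        clear hwM hinj hL₀ hwL hwT hT₁; grind
      have haT : a ∉ T := by
        rw [Finset.disjoint_left] at hLT
        clear hwM hinj hL₀ hwL hwT hT₁; grind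
      have hbT : b ∉ T := by
        rw [Finset.disjoint_left] at hLT
        clear hwM hinj hL₀ hwL hwT hT₁; grind
      have ha' := hwM a (Finset.mem_of_mem_erase ha)
      have hb' := hwM b (Finset.mem_of_mem_erase hb)
      have hab' := hinj a (Finset.mem_of_mem_erase ha) b (Finset.mem_of_mem_erase hb)
      by_cases h1 : a ∈ L <;> by_cases h2 : b ∈ L <;> simp only [h1, h2, if_true, if_false] at hab
      · exact hL₀ a (haL h1) b (hbL h2)
      · have := hb' h2 hbT; omega
      · have := ha' h1 haT; omega
      · exact hab' h1 haT h2 hbT (by omega)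

lemma SafeWeights.step {m : ℕ} {S : Finset V} {w : V → ℕ} (h : SafeWeights m S w)
    (hS : S.Nonempty) : ∃ Y ⊆ S, Y.Nonempty ∧ ∑ z ∈ Y, w z ≤ m ∧
      ∀ y ∈ Y, SafeWeights m (S.erase y) (nextWeights Y w) := by
  rcases h with h | ⟨i, hi, h⟩ | h
  · exact h.step hS
  · exact h.step hi hS
  · exact h.step hS

end Weights

/-! ### Waiter keeps a forest -/

section Waiter

lemma SafeWeights.congr {V : Type*} {m : ℕ} {S : Finset V} {w w' : V → ℕ}
    (h : SafeWeights m S w) (hw : ∀ z ∈ S, w' z = w z) : SafeWeights m S w' := by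
  rcases h with ⟨h1, h2⟩ | ⟨i, hi, L, T, l, hLS, hTS, hLT, hL, hT, hwL, hwT, hwM, hinj⟩ | ⟨l, hl, h⟩
  · exact .inl ⟨h1, fun z hz => (hw z hz).trans (h2 z hz)⟩
  · exact .inr (.inl ⟨i, hi, L, T, l, hLS, hTS, hLT, hL, hT,
      fun z hz => (hw z (hLS hz)).trans (hwL z hz),
      fun z hz => (hw z (hTS hz)).le.trans (hwT z hz),
      fun z hz h1 h2 => by rw [hw z hz]; exact hwM z hz h1 h2, hinj⟩)
  · exact .inr (.inr ⟨l, hl, fun z hz => by rw [hw z hz]; exact h z hz⟩)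

lemma reachable_deleteEdges_of_induce_connected {V : Type*} {G : SimpleGraph V} {B : Set V}
    (hB : (G.induce B).Connected) {a b u v : V} (hu : u ∈ B) (hv : v ∈ B) (hb : b ∉ B) :
    (G.deleteEdges {s(a, b)}).Reachable u v := by
  have h := hB.preconnected ⟨u, hu⟩ ⟨v, hv⟩
  let f : G.induce B →g G.deleteEdges {s(a, b)} :=
    { toFun := Subtype.val
      map_rel' := by
        rintro ⟨x, hx⟩ ⟨y, hy⟩ hxy
        rw [SimpleGraph.deleteEdges_adj]
        refine ⟨hxy, fun h => ?_⟩
        simp only [Set.mem_singleton_iff, Sym2.eq_iff] at h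
        rcases h with ⟨rfl, rfl⟩ | ⟨rfl, rfl⟩
        · exact hb hy
        · exact hb hx }
  exact h.map f

/-- An edge between two of the three branch sets is not a bridge: the third branch set provides a
detour. -/
lemma not_hasCliqueMinor_three_of_isAcyclic {V : Type*} {G : SimpleGraph V} (hG : G.IsAcyclic) :
    ¬ HasCliqueMinor G 3 := by
  rintro ⟨B, hconn, hdisj, hadj⟩
  obtain ⟨a, ha, b, hb, hab⟩ := hadj 0 1 (by decide)
  obtain ⟨c, hc, d, hd, hcd⟩ := hadj 1 2 (by decide)
  obtain ⟨e, he, f, hf, hef⟩ := hadj 2 0 (by decide)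
  have h01 := Set.disjoint_left.mp (hdisj 0 1 (by decide))
  have h12 := Set.disjoint_left.mp (hdisj 1 2 (by decide))
  have h20 := Set.disjoint_left.mp (hdisj 2 0 (by decide))
  have hbr := (SimpleGraph.isAcyclic_iff_forall_adj_isBridge.mp hG) hab
  rw [SimpleGraph.isBridge_iff] at hbr
  apply hbr
  have r0 : (G.deleteEdges {s(a, b)}).Reachable a f :=
    reachable_deleteEdges_of_induce_connected (hconn 0) ha hf (fun h => h01 h hb)
  have r1 : (G.deleteEdges {s(a, b)}).Reachable c b := by
    rw [Sym2.eq_swap]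
    exact reachable_deleteEdges_of_induce_connected (hconn 1) hc hb (fun h => h01 ha h)
  have r2 : (G.deleteEdges {s(a, b)}).Reachable e d :=
    reachable_deleteEdges_of_induce_connected (hconn 2) he hd (fun h => h12 hb h)
  have a1 : (G.deleteEdges {s(a, b)}).Adj f e := by
    rw [SimpleGraph.deleteEdges_adj]
    refine ⟨hef.symm, fun h => ?_⟩
    simp only [Set.mem_singleton_iff, Sym2.eq_iff] at h
    rcases h with ⟨rfl, rfl⟩ | ⟨rfl, rfl⟩
    · exact h12 hb he
    · exact h01 hf hb
  have a2 : (G.deleteEdges {s(a, b)}).Adj d c := by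
    rw [SimpleGraph.deleteEdges_adj]
    refine ⟨hcd.symm, fun h => ?_⟩
    simp only [Set.mem_singleton_iff, Sym2.eq_iff] at h
    rcases h with ⟨rfl, rfl⟩ | ⟨rfl, rfl⟩
    · exact h20 hd ha
    · exact h12 hb hd
  exact r0.trans (a1.reachable.trans (r2.trans (a2.reachable.trans r1)))

lemma graphOf_insert {n : ℕ} (E : Finset (Sym2 (Fin n))) (u v : Fin n) :
    graphOf (insert s(u, v) E) = graphOf E ⊔ SimpleGraph.edge u v := by
  ext a b
  simp only [graphOf, SimpleGraph.fromEdgeSet_adj, Finset.coe_insert, Set.mem_insert_iff,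
    SimpleGraph.sup_adj, SimpleGraph.edge_adj, Sym2.eq_iff]
  tauto

lemma isAcyclic_graphOf_insert {n : ℕ} {E : Finset (Sym2 (Fin n))} (hE : (graphOf E).IsAcyclic)
    {u v : Fin n} (huv : u ≠ v) (hv : ∀ e ∈ E, v ∉ e) :
    (graphOf (insert s(u, v) E)).IsAcyclic := by
  rw [graphOf_insert]
  refine hE.sup_edge_of_not_reachable fun h => ?_
  obtain ⟨p⟩ := h.symm
  cases p with
  | nil => exact huv rfl
  | cons hw _ =>
    simp only [graphOf, SimpleGraph.fromEdgeSet_adj, Finset.mem_coe] at hw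
    exact hv _ hw.1 (Sym2.mem_mk_left _ _)

/-- The invariant of Waiter's strategy: there is a set `C` of vertices that contains all of
Client's edges, all edges inside `C` have been offered, no edge outside `C` has been offered, and
the numbers of free edges from `C` to the other vertices are safe. -/
def WaiterInvariant {n : ℕ} (m : ℕ) (D E : Finset (Sym2 (Fin n))) : Prop :=
  ∃ C : Finset (Fin n), (∀ u ∈ C, ∀ v ∈ C, u ≠ v → s(u, v) ∈ D) ∧
    (∀ u ∉ C, ∀ v ∉ C, s(u, v) ∉ D) ∧ (∀ z ∉ C, ∃ u ∈ C, s(u, z) ∉ D) ∧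
    (∀ e ∈ E, ∀ v ∈ e, v ∈ C) ∧ (graphOf E).IsAcyclic ∧
    SafeWeights m Cᶜ (fun z => (C.filter fun u => s(u, z) ∉ D).card)

lemma WaiterInvariant.start {n m : ℕ} (hn : 1 ≤ n) (hm : n ≤ 2 * m) :
    WaiterInvariant (n := n) m ∅ ∅ := by
  refine ⟨{⟨0, hn⟩}, ?_, by simp, by simp, by simp, ?_, .inl ⟨?_, ?_⟩⟩
  · intro u hu v hv h
    rw [Finset.mem_singleton] at hu hv
    exact absurd (hu.trans hv.symm) h
  · simp [graphOf]
  · rw [Finset.card_compl]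
    simp only [Fintype.card_fin, Finset.card_singleton]; omega
  · intro z _; simp

lemma WaiterInvariant.step {n m : ℕ} {D E : Finset (Sym2 (Fin n))} (h : WaiterInvariant m D E)
    (hfree : (completeBoard n \ D).Nonempty) :
    ∃ O : Finset (Sym2 (Fin n)), O.Nonempty ∧ O.card ≤ m ∧ O ⊆ completeBoard n \ D ∧
      ∀ x ∈ O, WaiterInvariant m (O ∪ D) (insert x E) := by
  obtain ⟨C, hin, hout, hpos, hEC, hacyc, hsafe⟩ := h
  have hS : Cᶜ.Nonempty := by
    obtain ⟨e, he⟩ := hfree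
    by_contra hC
    rw [Finset.not_nonempty_iff_eq_empty, Finset.compl_eq_empty_iff] at hC
    subst hC
    induction e with | _ u v =>
    simp only [completeBoard, Finset.mem_sdiff, SimpleGraph.mem_edgeFinset,
      SimpleGraph.mem_edgeSet, SimpleGraph.top_adj] at he
    exact he.2 (hin u (Finset.mem_univ _) v (Finset.mem_univ _) he.1)
  obtain ⟨Y, hYC, hY, hsum, hnext⟩ := hsafe.step hS
  have hYC' : ∀ z ∈ Y, z ∉ C := fun z hz => Finset.mem_compl.mp (hYC hz)
  let O : Finset (Sym2 (Fin n)) :=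
    Y.biUnion fun z => (C.filter fun u => s(u, z) ∉ D).image fun u => s(u, z)
  have hO : ∀ e, e ∈ O ↔ ∃ z ∈ Y, ∃ u ∈ C, s(u, z) ∉ D ∧ s(u, z) = e := by
    intro e
    simp only [O, Finset.mem_biUnion, Finset.mem_image, Finset.mem_filter]
    grind
  refine ⟨O, ?_, ?_, ?_, ?_⟩
  · obtain ⟨z, hz⟩ := hY
    obtain ⟨u, hu, hD⟩ := hpos z (hYC' z hz)
    exact ⟨_, (hO _).mpr ⟨z, hz, u, hu, hD, rfl⟩⟩
  · refine (Finset.card_biUnion_le.trans (Finset.sum_le_sum fun z _ => ?_)).trans hsum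
    exact Finset.card_image_le
  · intro e he
    obtain ⟨z, hz, u, hu, hD, rfl⟩ := (hO e).mp he
    simp only [completeBoard, Finset.mem_sdiff, SimpleGraph.mem_edgeFinset,
      SimpleGraph.mem_edgeSet, SimpleGraph.top_adj]
    exact ⟨fun h => hYC' z hz (h ▸ hu), hD⟩
  · intro e he
    obtain ⟨y, hy, x, hx, hD, rfl⟩ := (hO e).mp he
    have hyC := hYC' y hy
    have hOin : ∀ u ∈ C, ∀ z ∉ C, (s(u, z) ∈ O ↔ z ∈ Y ∧ s(u, z) ∉ D) := by
      intro u hu z hz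
      rw [hO]
      constructor
      · rintro ⟨z', hz', u', hu', h, he⟩
        rcases Sym2.eq_iff.mp he with ⟨rfl, rfl⟩ | ⟨rfl, rfl⟩
        · exact ⟨hz', h⟩
        · exact absurd hu' hz
      · exact fun h => ⟨z, h.1, u, hu, h.2, rfl⟩
    have hOout : ∀ u ∉ C, ∀ v ∉ C, s(u, v) ∉ O := by
      intro u hu v hv h
      obtain ⟨z', hz', u', hu', h, he⟩ := (hO _).mp h
      rcases Sym2.eq_iff.mp he with ⟨rfl, rfl⟩ | ⟨rfl, rfl⟩
      · exact hu hu'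
      · exact hv hu'
    refine ⟨insert y C, ?_, ?_, ?_, ?_, ?_, ?_⟩
    · have hyu : ∀ u ∈ C, s(u, y) ∈ O ∪ D := by
        intro u hu
        by_cases h : s(u, y) ∈ D
        · exact Finset.mem_union_right _ h
        · exact Finset.mem_union_left _ ((hOin u hu y hyC).mpr ⟨hy, h⟩)
      intro u hu v hv huv
      rcases Finset.mem_insert.mp hu with hu' | hu' <;>
        rcases Finset.mem_insert.mp hv with hv' | hv'
      · exact absurd (hu'.trans hv'.symm) huv
      · rw [hu', Sym2.eq_swap]; exact hyu v hv'
      · rw [hv']; exact hyu u hu'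
      · exact Finset.mem_union_right _ (hin u hu' v hv' huv)
    · intro u hu v hv
      simp only [Finset.mem_insert, not_or] at hu hv
      rw [Finset.mem_union, not_or]
      exact ⟨hOout u hu.2 v hv.2, hout u hu.2 v hv.2⟩
    · intro z hz
      simp only [Finset.mem_insert, not_or] at hz
      refine ⟨y, Finset.mem_insert_self _ _, ?_⟩
      rw [Finset.mem_union, not_or]
      exact ⟨hOout y hyC z hz.2, hout y hyC z hz.2⟩
    · intro e he v hv
      rcases Finset.mem_insert.mp he with rfl | he
      · rcases Sym2.mem_iff.mp hv with rfl | rfl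
        · exact Finset.mem_insert_of_mem hx
        · exact Finset.mem_insert_self _ _
      · exact Finset.mem_insert_of_mem (hEC e he v hv)
    · exact isAcyclic_graphOf_insert hacyc (fun h => hyC (h ▸ hx)) fun e he hv => hyC (hEC e he y hv)
    · rw [Finset.compl_insert]
      refine (hnext y hy).congr fun z hz => ?_
      obtain ⟨hzy, hzC⟩ := Finset.mem_erase.mp hz
      rw [Finset.mem_compl] at hzC
      have hyz : s(y, z) ∉ O ∪ D := by
        rw [Finset.mem_union, not_or]
        exact ⟨hOout y hyC z hzC, hout y hyC z hzC⟩
      rw [Finset.filter_insert, if_pos hyz,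
        Finset.card_insert_of_notMem (fun h => hyC (Finset.mem_filter.mp h).1)]
      unfold nextWeights
      split_ifs with hzY
      · rw [Nat.add_eq_right, Finset.card_eq_zero, Finset.filter_eq_empty_iff]
        intro u hu h
        rw [Finset.mem_union, not_or, hOin u hu z hzC] at h
        tauto
      · congr 2
        refine Finset.filter_congr fun u hu => ?_
        rw [Finset.mem_union, hOin u hu z hzC]
        tauto

theorem waiterCanKeep_not_hasCliqueMinor_three {n q : ℕ} (hn : 1 ≤ n) (hq : n ≤ 2 * (q + 1)) :
    WaiterCanKeep q (completeBoard n) (fun E => ¬ HasCliqueMinor (graphOf E) 3) :=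
  waiterCanKeep_of_invariant (WaiterInvariant (q + 1)) (.start hn hq)
    (fun _ _ ⟨_, _, _, _, _, h, _⟩ => not_hasCliqueMinor_three_of_isAcyclic h)
    (fun _ _ h hf => h.step hf)

end Waiter

/-! ### Derandomised play of Client -/

section Potential

variable {α ι : Type*} [DecidableEq α]

/-- The expected number of sets `K a` that end up in Client's virtual set, if `D` is the set of
offered elements, `H` is Client's virtual set and every element outside `D` is added to it
independently with probability `p`. -/
def danger (p : ℝ) (K : Finset α) (D H : Finset α) : ℝ :=
  if K ∩ D ⊆ H then p ^ (K \ D).card else 0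

/-- The expected final size of Client's virtual set minus the expected number of sets `K a` in it. -/
def potential (p : ℝ) (X : Finset α) (I : Finset ι) (K : ι → Finset α) (D H : Finset α) : ℝ :=
  H.card + p * (X \ D).card - ∑ a ∈ I, danger p (K a) D H

/-- At most one element of `O` enters `H`. A set `K` that misses `O` is unaffected; one that meets
`O` in a single element survives only that choice, whose weight `p` is the factor already counted;
one that meets `O` twice dies, which only helps. -/
lemma danger_average {p : ℝ} (hp : 0 ≤ p) (K : Finset α) {D H O : Finset α} (hHD : H ⊆ D)
    (hOD : Disjoint O D) :
    (1 - p * O.card) * danger p K (O ∪ D) H + p * ∑ x ∈ O, danger p K (O ∪ D) (insert x H) ≤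
      danger p K D H := by
  rw [Finset.disjoint_left] at hOD
  by_cases hK : K ∩ D ⊆ H
  swap
  · have h0 : ∀ x ∈ O, danger p K (O ∪ D) (insert x H) = 0 := by
      intro x hx
      refine if_neg fun h => hK fun y hy => ?_
      have := hOD hx
      have := h (show y ∈ K ∩ (O ∪ D) by grind)
      grind
    have h1 : danger p K (O ∪ D) H = 0 := if_neg fun h => hK fun y hy => h (by grind)
    rw [Finset.sum_eq_zero h0, h1, danger, if_neg hK]
    simp
  by_cases hO : K ∩ O = ∅
  · have hcard : K \ (O ∪ D) = K \ D := by
      ext y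
      have : y ∈ K → y ∉ O := fun h h' => by
        have : y ∈ K ∩ O := Finset.mem_inter.mpr ⟨h, h'⟩
        simp [hO] at this
      simp only [Finset.mem_sdiff, Finset.mem_union]; tauto
    have hsub : K ∩ (O ∪ D) ⊆ H := by rw [Finset.inter_union_distrib_left, hO]; simpa using hK
    have h0 : ∀ x ∈ O, danger p K (O ∪ D) (insert x H) = p ^ (K \ D).card := by
      intro x hx
      rw [danger, if_pos (hsub.trans (Finset.subset_insert _ _)), hcard]
    rw [Finset.sum_congr rfl h0, danger, danger, if_pos hsub, if_pos hK, hcard, Finset.sum_const,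
      nsmul_eq_mul]
    exact le_of_eq (by ring)
  obtain ⟨y, hy⟩ := Finset.nonempty_iff_ne_empty.mpr hO
  obtain ⟨hyK, hyO⟩ := Finset.mem_inter.mp hy
  have hyH : y ∉ H := fun h => hOD hyO (hHD h)
  have h1 : danger p K (O ∪ D) H = 0 :=
    if_neg fun h => hyH (h (by simp [hyK, hyO]))
  have h2 : ∀ x ∈ O, x ≠ y → danger p K (O ∪ D) (insert x H) = 0 := by
    intro x hx hxy
    refine if_neg fun h => ?_
    have := h (show y ∈ K ∩ (O ∪ D) by simp [hyK, hyO])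
    rcases Finset.mem_insert.mp this with h' | h'
    · exact hxy h'.symm
    · exact hyH h'
  rw [h1, Finset.sum_eq_single_of_mem y hyO h2, mul_zero, zero_add, danger, danger, if_pos hK]
  split_ifs with h
  · have hins : K \ D = insert y (K \ (O ∪ D)) := by
      ext z
      have h3 := hOD hyO
      have h4 : z ∈ K → z ∈ O → z = y := fun hz hz' => by
        have := h (show z ∈ K ∩ (O ∪ D) by simp [hz, hz'])
        rcases Finset.mem_insert.mp this with h' | h'
        · exact h'
        · exact absurd (hHD h') (hOD hz')
      simp only [Finset.mem_insert, Finset.mem_sdiff, Finset.mem_union, not_or]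
      constructor
      · grind
      · rintro (rfl | h)
        · exact ⟨hyK, h3⟩
        · exact ⟨h.1, h.2.2⟩
    rw [hins, Finset.card_insert_of_notMem (by simp [hyO]), pow_succ, mul_comm]
  · rw [mul_zero]; positivity

/-- The right side averages over a virtual move that adds each `x ∈ O` with probability `p` and
nothing otherwise. This is a probability distribution when `p * O.card ≤ 1`. -/
lemma potential_average {p : ℝ} (hp : 0 ≤ p) {X : Finset α} (I : Finset ι) (K : ι → Finset α)
    {D H O : Finset α} (hHD : H ⊆ D) (hOX : O ⊆ X \ D) :
    potential p X I K D H ≤ (1 - p * O.card) * potential p X I K (O ∪ D) H +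
      p * ∑ x ∈ O, potential p X I K (O ∪ D) (insert x H) := by
  have hOD : Disjoint O D := Finset.disjoint_of_subset_left hOX Finset.sdiff_disjoint
  have hsum : (1 - p * O.card) * ∑ a ∈ I, danger p (K a) (O ∪ D) H +
      p * ∑ x ∈ O, ∑ a ∈ I, danger p (K a) (O ∪ D) (insert x H) ≤
      ∑ a ∈ I, danger p (K a) D H := by
    rw [Finset.sum_comm, Finset.mul_sum, Finset.mul_sum, ← Finset.sum_add_distrib]
    exact Finset.sum_le_sum fun a _ => danger_average hp (K a) hHD hOD
  have hcard : ∀ x ∈ O, ((insert x H).card : ℝ) = H.card + 1 := by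
    intro x hx
    rw [Finset.card_insert_of_notMem fun h => Finset.disjoint_left.mp hOD hx (hHD h)]
    push_cast; rfl
  have hfree : ((X \ (O ∪ D)).card : ℝ) = (X \ D).card - O.card := by
    rw [Finset.union_comm, ← Finset.sup_eq_union, ← sdiff_sdiff_left, Finset.card_sdiff_of_subset hOX,
      Nat.cast_sub (Finset.card_le_card hOX)]
  simp only [potential, Finset.sum_sub_distrib, Finset.sum_add_distrib, Finset.sum_const,
    nsmul_eq_mul, Finset.sum_congr rfl hcard, hfree]
  linarith [hsum]

/-- If `p (q + 1) ≤ 1`, then Client can claim a set that has at least as many elements, compared to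
the number of sets `K a` in it, as a random set of density `p` has on average. -/
theorem clientCanBuild_of_expectation {p : ℝ} {q : ℕ} (hp : 0 < p) (hpq : p * (q + 1) ≤ 1)
    {X : Finset α} (hX : X.Nonempty) (I : Finset ι) (K : ι → Finset α) (hK : ∀ a ∈ I, K a ⊆ X)
    {P : Finset α → Prop}
    (hP : ∀ E H : Finset α, E ⊆ X → E.Nonempty → H ⊆ E →
      p * X.card - ∑ a ∈ I, p ^ (K a).card ≤ H.card - ((I.filter fun a => K a ⊆ H).card : ℝ) →
      P E) :
    ClientCanBuild q X P := by
  refine clientCanBuild_of_invariant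
    (fun D E => ∃ H ⊆ E, H ⊆ D ∧ potential p X I K ∅ ∅ ≤ potential p X I K D H) hX
    ⟨∅, subset_rfl, subset_rfl, le_rfl⟩ ?_ ?_
  · rintro E hEX hE ⟨H, hHE, hHX, hpot⟩
    refine hP E H hEX hE hHE ?_
    have h1 : ∑ a ∈ I, danger p (K a) X H = (I.filter fun a => K a ⊆ H).card := by
      rw [Finset.card_filter, Nat.cast_sum]
      refine Finset.sum_congr rfl fun a ha => ?_
      rw [danger, Finset.inter_eq_left.mpr (hK a ha), Finset.sdiff_eq_empty_iff_subset.mpr (hK a ha)]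
      simp
    rw [potential, potential, h1] at hpot
    simpa [danger] using hpot
  · rintro D E O ⟨H, hHE, hHD, hpot⟩ hO hOq hOX
    have havg := hpot.trans (potential_average hp.le I K hHD hOX)
    -- If ignoring the offer is good enough, the virtual set stays as it is and Client claims any
    -- edge; otherwise, by averaging, some edge is worth adding.
    by_cases hkeep : potential p X I K ∅ ∅ ≤ potential p X I K (O ∪ D) H
    · obtain ⟨x, hx⟩ := hO
      exact ⟨x, hx, H, hHE.trans (Finset.subset_insert _ _),
        hHD.trans Finset.subset_union_right, hkeep⟩
    · by_contra hcon
      push Not at hcon hkeep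
      have h1 : ∀ x ∈ O, potential p X I K (O ∪ D) (insert x H) < potential p X I K ∅ ∅ :=
        fun x hx => hcon x hx _ (Finset.insert_subset_insert _ hHE)
          (Finset.insert_subset (Finset.mem_union_left _ hx) (hHD.trans Finset.subset_union_right))
      have h2 := Finset.sum_lt_sum_of_nonempty hO h1
      rw [Finset.sum_const, nsmul_eq_mul] at h2
      have h3 : p * O.card ≤ 1 := by
        refine le_trans (mul_le_mul_of_nonneg_left ?_ hp.le) hpq
        exact_mod_cast hOq
      have h4 := mul_lt_mul_of_pos_left h2 hp
      have h5 := mul_le_mul_of_nonneg_left hkeep.le (sub_nonneg.mpr h3)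
      linarith

end Potential

/-! ### Short cycles and their removal -/

section Girth

/-- All cycles of `G` have more than `k` edges. -/
def HighGirth {V : Type*} (k : ℕ) (G : SimpleGraph V) : Prop :=
  ∀ (v : V) (c : G.Walk v v), c.IsCycle → k < c.length

/-- The edges of the closed walk through `f 0, f 1, …, f (j - 1)`. -/
def cyclicEdges {V : Type*} [DecidableEq V] {j : ℕ} (f : Fin j → V) : Finset (Sym2 V) :=
  Finset.univ.image fun i : Fin j => s(f i, f ⟨(i + 1) % j, Nat.mod_lt _ i.pos⟩)

lemma cyclicEdges_of_isCycle {V : Type*} [DecidableEq V] {G : SimpleGraph V} {v : V}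
    {c : G.Walk v v} (hc : c.IsCycle) :
    (cyclicEdges fun i : Fin c.length => c.getVert i).card = c.length ∧
      ∀ e ∈ cyclicEdges (fun i : Fin c.length => c.getVert i), e ∈ G.edgeSet := by
  have h3 := hc.three_le_length
  have hmod : ∀ i < c.length, c.getVert ((i + 1) % c.length) = c.getVert (i + 1) := by
    intro i hi
    rcases Nat.lt_or_ge (i + 1) c.length with h | h
    · rw [Nat.mod_eq_of_lt h]
    · have : i + 1 = c.length := by omega
      rw [this, Nat.mod_self, SimpleGraph.Walk.getVert_zero, SimpleGraph.Walk.getVert_length]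
  have hinj : ∀ i < c.length, ∀ l < c.length, c.getVert i = c.getVert l → i = l := by
    intro i hi l hl h
    exact hc.getVert_injOn' (show i ≤ c.length - 1 by omega) (show l ≤ c.length - 1 by omega) h
  constructor
  · rw [cyclicEdges, Finset.card_image_of_injective, Finset.card_univ, Fintype.card_fin]
    rintro ⟨i, hi⟩ ⟨l, hl⟩ h
    have hsucc : ∀ i < c.length, (i + 1) % c.length = i + 1 ∨
        ((i + 1) % c.length = 0 ∧ i + 1 = c.length) := by
      intro i hi
      rcases Nat.lt_or_ge (i + 1) c.length with h | h
      · exact .inl (Nat.mod_eq_of_lt h)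
      · have : i + 1 = c.length := by omega
        exact .inr ⟨by rw [this, Nat.mod_self], this⟩
    rcases Sym2.eq_iff.mp h with ⟨h1, -⟩ | ⟨h1, h2⟩
    · exact Fin.ext (hinj i hi l hl h1)
    · have h1' := hinj i hi _ (Nat.mod_lt _ (by omega)) h1
      have h2' := hinj _ (Nat.mod_lt _ (by omega)) l hl h2
      exfalso
      rcases hsucc i hi with h | ⟨h, h'⟩ <;> rcases hsucc l hl with h₀ | ⟨h₀, h₀'⟩ <;>
        rw [h] at h2' <;> rw [h₀] at h1' <;> omega
  · intro e he
    obtain ⟨⟨i, hi⟩, -, rfl⟩ := Finset.mem_image.mp he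
    simp only [hmod i hi, SimpleGraph.mem_edgeSet]
    exact c.adj_getVert_succ hi

/-- Client can build a graph of large girth with many edges. -/
theorem clientCanBuild_of_highGirth {n q k : ℕ} {p : ℝ} (hn : 2 ≤ n) (hp : 0 < p)
    (hpq : p * (q + 1) ≤ 1) {P : Finset (Sym2 (Fin n)) → Prop}
    (hmono : ∀ H E, H ⊆ E → P H → P E)
    (hP : ∀ H ⊆ completeBoard n,
      p * (completeBoard n).card - ∑ j ∈ Finset.Icc 3 k, (n * p) ^ j ≤ (H.card : ℝ) →
      HighGirth k (graphOf H) → P H) :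
    ClientCanBuild q (completeBoard n) P := by
  classical
  have hne : (completeBoard n).Nonempty := by
    refine ⟨s(⟨0, by omega⟩, ⟨1, by omega⟩), ?_⟩
    simp [completeBoard]
  -- Cycles are indexed by vertex sequences, hence with repetitions. This is harmless: only the
  -- bound `n ^ j` on the number of sequences of length `j` is used.
  let I : Finset (Σ j : ℕ, Fin j → Fin n) := (Finset.Icc 3 k).sigma fun j =>
    Finset.univ.filter fun f => (cyclicEdges f).card = j ∧ cyclicEdges f ⊆ completeBoard n
  have hI : ∀ a, a ∈ I ↔ (3 ≤ a.1 ∧ a.1 ≤ k) ∧ (cyclicEdges a.2).card = a.1 ∧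
      cyclicEdges a.2 ⊆ completeBoard n := by
    intro a; simp [I]
  refine clientCanBuild_of_expectation hp hpq hne I (fun a => cyclicEdges a.2)
    (fun a ha => ((hI a).mp ha).2.2) ?_
  intro E H hEX _ hHE hH
  have hsum : ∑ a ∈ I, p ^ (cyclicEdges a.2).card ≤ ∑ j ∈ Finset.Icc 3 k, (n * p) ^ j := by
    rw [Finset.sum_sigma]
    refine Finset.sum_le_sum fun j _ => ?_
    rw [Finset.sum_congr rfl (g := fun _ => p ^ j)
      (fun f hf => by rw [(Finset.mem_filter.mp hf).2.1]), Finset.sum_const, nsmul_eq_mul, mul_pow]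
    refine mul_le_mul_of_nonneg_right ?_ (by positivity)
    have := Finset.card_filter_le (Finset.univ : Finset (Fin j → Fin n))
      (fun f => (cyclicEdges f).card = j ∧ cyclicEdges f ⊆ completeBoard n)
    rw [Finset.card_univ, Fintype.card_fun, Fintype.card_fin, Fintype.card_fin] at this
    exact_mod_cast this
  have hchoose : ∀ a : Σ j : ℕ, Fin j → Fin n, ∃ e, a ∈ I → e ∈ cyclicEdges a.2 := by
    intro a
    by_cases ha : a ∈ I
    · have h := (hI a).mp ha
      obtain ⟨e, he⟩ := Finset.card_pos.mp (by omega : 0 < (cyclicEdges a.2).card)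
      exact ⟨e, fun _ => he⟩
    · exact ⟨hne.choose, fun h => absurd h ha⟩
  choose g hg using hchoose
  -- Alteration: one edge `g a` is deleted for each short cycle `a` in `H`.
  let B := I.filter fun a => cyclicEdges a.2 ⊆ H
  refine hmono (H \ B.image g) E (Finset.sdiff_subset.trans hHE) (hP _ ?_ ?_ ?_)
  · exact Finset.sdiff_subset.trans (hHE.trans hEX)
  · have h1 : H.card ≤ (H \ B.image g).card + B.card := by
      have := Finset.le_card_sdiff (B.image g) H
      have := Finset.card_image_le (s := B) (f := g)
      omega
    have h2 : (H.card : ℝ) ≤ (H \ B.image g).card + B.card := by exact_mod_cast h1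
    simp only [B] at h2 ⊢
    linarith
  · intro v c hc
    by_contra hk
    have h := cyclicEdges_of_isCycle hc
    have hsub : cyclicEdges (fun i : Fin c.length => c.getVert i) ⊆ H \ B.image g := by
      intro e he
      have := h.2 e he
      rw [graphOf, SimpleGraph.edgeSet_fromEdgeSet] at this
      exact this.1
    have hmem : (⟨c.length, fun i => c.getVert i⟩ : Σ j : ℕ, Fin j → Fin n) ∈ I :=
      (hI _).mpr ⟨⟨hc.three_le_length, not_lt.mp hk⟩, h.1,
        hsub.trans (Finset.sdiff_subset.trans (hHE.trans hEX))⟩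
    have := Finset.mem_sdiff.mp (hsub (hg _ hmem))
    exact this.2 (Finset.mem_image_of_mem g
      (Finset.mem_filter.mpr ⟨hmem, hsub.trans Finset.sdiff_subset⟩))

/-- Shortcutting the walk to a path and adding the edge closes a cycle. -/
lemma HighGirth.lt_length {V : Type*} {k : ℕ} {G : SimpleGraph V} (hG : HighGirth k G) {x y : V}
    (hxy : G.Adj x y) (w : G.Walk x y) (hw : s(x, y) ∉ w.edges) : k < w.length + 1 := by
  classical
  have hw' : s(y, x) ∉ w.bypass.edges := fun h =>
    hw (by rw [Sym2.eq_swap]; exact w.edges_bypass_subset_edges h)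
  have h := hG y (.cons hxy.symm w.bypass)
    ((SimpleGraph.Walk.cons_isCycle_iff _ _).mpr ⟨w.bypass_isPath, hw'⟩)
  have := w.length_bypass_le_length
  simp only [SimpleGraph.Walk.length_cons] at h
  omega

end Girth

/-! ### Breadth-first forests in graphs of large girth -/

section Forest

variable {W : Type*} {G : SimpleGraph W}

/-- A breadth-first search from `Z`. -/
lemma exists_parent (G : SimpleGraph W) (Z : Set W) :
    ∃ π : W → W, (∀ z ∈ Z, π z = z) ∧ (∀ y, π y = y ∨ G.Adj y (π y)) ∧
      ∀ (i : ℕ) (y z : W), z ∈ Z → (∃ w : G.Walk y z, w.length ≤ i) → π^[i] y ∈ Z := by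
  classical
  -- The parent is the next vertex on a shortest walk to `Z`. Vertices of `Z`, and those that cannot
  -- reach `Z`, are their own parents.
  have key : ∀ y, ∃ u, (y ∈ Z → u = y) ∧ (u = y ∨ G.Adj y u) ∧
      ∀ (i : ℕ) (z : W), z ∈ Z → (∃ w : G.Walk y z, w.length ≤ i + 1) →
        ∃ z' ∈ Z, ∃ w : G.Walk u z', w.length ≤ i := by
    intro y
    by_cases hy : y ∈ Z
    · exact ⟨y, fun _ => rfl, .inl rfl, fun i _ _ _ => ⟨y, hy, .nil, Nat.zero_le _⟩⟩
    by_cases hr : ∃ l : ℕ, ∃ z ∈ Z, ∃ w : G.Walk y z, w.length = l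
    · obtain ⟨z, hz, w, hw⟩ := Nat.find_spec hr
      have hmin : ∀ z' ∈ Z, ∀ w' : G.Walk y z', w.length ≤ w'.length := fun z' hz' w' =>
        hw.le.trans (Nat.find_min' hr ⟨z', hz', w', rfl⟩)
      cases w with
      | nil => exact absurd hz hy
      | @cons _ u _ h w =>
        refine ⟨u, fun h => absurd h hy, .inr h, fun i z' hz' hw' => ⟨z, hz, w, ?_⟩⟩
        obtain ⟨w', hw'⟩ := hw'
        have := hmin z' hz' w'
        rw [SimpleGraph.Walk.length_cons] at this
        omega
    · exact ⟨y, fun _ => rfl, .inl rfl, fun i z hz hw => absurd ⟨_, z, hz, hw.choose, rfl⟩ hr⟩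
  choose π h1 h2 h3 using key
  refine ⟨π, h1, h2, fun i => ?_⟩
  induction i with
  | zero =>
    rintro y z hz ⟨w, hw⟩
    cases w with
    | nil => exact hz
    | cons _ _ => simp at hw
  | succ i ih =>
    intro y z hz hw
    obtain ⟨z', hz', hw'⟩ := h3 y i z hz hw
    exact ih (π y) z' hz' hw'

lemma exists_walk_iterate {π : W → W} (hπ : ∀ y, π y = y ∨ G.Adj y (π y)) (i : ℕ) (y : W) :
    ∃ w : G.Walk y (π^[i] y), w.length ≤ i ∧ ∀ e ∈ w.edges, ∃ v, e = s(v, π v) := by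
  induction i generalizing y with
  | zero => exact ⟨.nil, by simp, by simp⟩
  | succ i ih =>
    obtain ⟨w, hw, hwe⟩ := ih (π y)
    rw [Function.iterate_succ_apply]
    rcases hπ y with h | h
    · refine ⟨w.copy h rfl, ?_, ?_⟩
      · rw [SimpleGraph.Walk.length_copy]; omega
      · intro e he
        rw [SimpleGraph.Walk.edges_copy] at he
        exact hwe e he
    · refine ⟨.cons h w, ?_, ?_⟩
      · rw [SimpleGraph.Walk.length_cons]; omega
      · intro e he
        rw [SimpleGraph.Walk.edges_cons, List.mem_cons] at he
        rcases he with rfl | he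
        · exact ⟨y, rfl⟩
        · exact hwe e he

/-- If both ends led to the same root, the two forest walks and the non-forest edge would contain a
cycle of length at most `2R + 1`. -/
lemma HighGirth.iterate_ne {k R : ℕ} (hG : HighGirth k G) (hk : 2 * R + 1 ≤ k) {π : W → W}
    (hπ : ∀ y, π y = y ∨ G.Adj y (π y)) {x y : W} (hxy : G.Adj x y)
    (hF : ∀ v, s(x, y) ≠ s(v, π v)) : π^[R] x ≠ π^[R] y := by
  intro h
  obtain ⟨w, hw, hwe⟩ := exists_walk_iterate hπ R x
  obtain ⟨w', hw', hwe'⟩ := exists_walk_iterate hπ R y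
  have hlen := hG.lt_length hxy (w.append (w'.reverse.copy h.symm rfl)) (by
    rw [SimpleGraph.Walk.edges_append, SimpleGraph.Walk.edges_copy, SimpleGraph.Walk.edges_reverse,
      List.mem_append, List.mem_reverse]
    rintro (he | he)
    · obtain ⟨v, hv⟩ := hwe _ he
      exact hF v hv
    · obtain ⟨v, hv⟩ := hwe' _ he
      exact hF v hv)
  rw [SimpleGraph.Walk.length_append, SimpleGraph.Walk.length_copy,
    SimpleGraph.Walk.length_reverse] at hlen
  omega

/-- Two different edges between the same two trees, with four forest walks of length at most `R`,
would yield a cycle of length at most `4R + 2`. Only the first edge has to lie outside the forest.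
-/
lemma HighGirth.edge_unique {k R : ℕ} (hG : HighGirth k G) (hk : 4 * R + 2 ≤ k) {π : W → W}
    (hπ : ∀ y, π y = y ∨ G.Adj y (π y)) {x y x' y' : W} (hxy : G.Adj x y) (hxy' : G.Adj x' y')
    (hF : ∀ v, s(x, y) ≠ s(v, π v)) (hx : π^[R] x = π^[R] x') (hy : π^[R] y = π^[R] y') :
    s(x, y) = s(x', y') := by
  by_contra hne
  obtain ⟨w₁, hw₁, hwe₁⟩ := exists_walk_iterate hπ R x
  obtain ⟨w₂, hw₂, hwe₂⟩ := exists_walk_iterate hπ R x'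
  obtain ⟨w₃, hw₃, hwe₃⟩ := exists_walk_iterate hπ R y'
  obtain ⟨w₄, hw₄, hwe₄⟩ := exists_walk_iterate hπ R y
  have hlen := hG.lt_length hxy ((w₁.append (w₂.reverse.copy hx.symm rfl)).append
    (.cons hxy' (w₃.append (w₄.reverse.copy hy rfl)))) (by
    simp only [SimpleGraph.Walk.edges_append, SimpleGraph.Walk.edges_copy,
      SimpleGraph.Walk.edges_reverse, SimpleGraph.Walk.edges_cons, List.mem_append,
      List.mem_reverse, List.mem_cons]
    rintro ((he | he) | he | he | he)
    · obtain ⟨v, hv⟩ := hwe₁ _ he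
      exact hF v hv
    · obtain ⟨v, hv⟩ := hwe₂ _ he
      exact hF v hv
    · exact hne he
    · obtain ⟨v, hv⟩ := hwe₃ _ he
      exact hF v hv
    · obtain ⟨v, hv⟩ := hwe₄ _ he
      exact hF v hv)
  simp only [SimpleGraph.Walk.length_append, SimpleGraph.Walk.length_copy,
    SimpleGraph.Walk.length_reverse, SimpleGraph.Walk.length_cons] at hlen
  omega

end Forest

/-! ### Growth of balls -/

section Balls

variable {W : Type*}

open Classical in
/-- The ordered pairs of adjacent vertices in `S`. -/
noncomputable def adjPairs (G : SimpleGraph W) (S : Finset W) : Finset (W × W) :=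
  (S ×ˢ S).filter fun e => G.Adj e.1 e.2

lemma mem_adjPairs {G : SimpleGraph W} {S : Finset W} {e : W × W} :
    e ∈ adjPairs G S ↔ (e.1 ∈ S ∧ e.2 ∈ S) ∧ G.Adj e.1 e.2 := by
  simp [adjPairs]

/-- Removing vertices from `G` removes more than `1 + δ` edges per vertex. -/
def CriticallyDense [Fintype W] [DecidableEq W] (δ : ℝ) (G : SimpleGraph W) : Prop :=
  ∀ S : Finset W, S.Nonempty →
    2 * (1 + δ) * S.card + (adjPairs G Sᶜ).card ≤ (adjPairs G Finset.univ).card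

variable [Fintype W]

open Classical in
/-- The vertices at distance at most `j` from `x`. -/
noncomputable def ball (G : SimpleGraph W) (x : W) (j : ℕ) : Finset W :=
  Finset.univ.filter fun y => ∃ w : G.Walk y x, w.length ≤ j

variable {G : SimpleGraph W}

lemma mem_ball {x y : W} {j : ℕ} : y ∈ ball G x j ↔ ∃ w : G.Walk y x, w.length ≤ j := by
  simp [ball]

lemma self_mem_ball (x : W) (j : ℕ) : x ∈ ball G x j := mem_ball.mpr ⟨.nil, by simp⟩

lemma ball_subset_succ (x : W) (j : ℕ) : ball G x j ⊆ ball G x (j + 1) := fun y hy => by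
  obtain ⟨w, hw⟩ := mem_ball.mp hy
  exact mem_ball.mpr ⟨w, by omega⟩

lemma mem_ball_succ_of_adj {x y z : W} {j : ℕ} (hy : y ∈ ball G x j) (h : G.Adj z y) :
    z ∈ ball G x (j + 1) := by
  obtain ⟨w, hw⟩ := mem_ball.mp hy
  exact mem_ball.mpr ⟨.cons h w, by rw [SimpleGraph.Walk.length_cons]; omega⟩

/-- By the girth, every edge inside the ball is a parent edge of the search tree from `x`, and `x`
has no parent edge. Ordered pairs account for the factor two. -/
lemma HighGirth.adjPairs_ball {k j : ℕ} (hG : HighGirth k G) (hk : 2 * j + 1 ≤ k) (x : W) :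
    (adjPairs G (ball G x j)).card + 2 ≤ 2 * (ball G x j).card := by
  classical
  obtain ⟨π, hπZ, hπ, hπi⟩ := exists_parent G {x}
  have hsub : adjPairs G (ball G x j) ⊆
      ((ball G x j).erase x).image (fun v => (v, π v)) ∪
      ((ball G x j).erase x).image (fun v => (π v, v)) := by
    rintro ⟨a, b⟩ hab
    obtain ⟨⟨ha, hb⟩, hadj⟩ := mem_adjPairs.mp hab
    simp only at ha hb hadj
    have hx : π x = x := hπZ x rfl
    have hF : ∃ v, s(a, b) = s(v, π v) := by
      by_contra hF
      push Not at hF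
      refine hG.iterate_ne hk hπ hadj hF ?_
      rw [show π^[j] a = x from hπi j a x rfl (mem_ball.mp ha),
        show π^[j] b = x from hπi j b x rfl (mem_ball.mp hb)]
    obtain ⟨v, hv⟩ := hF
    rcases Sym2.eq_iff.mp hv with ⟨rfl, rfl⟩ | ⟨rfl, rfl⟩
    · refine Finset.mem_union_left _ (Finset.mem_image_of_mem (fun v => (v, π v)) ?_)
      exact Finset.mem_erase.mpr ⟨fun h => hadj.ne (by rw [h, hx]), ha⟩
    · refine Finset.mem_union_right _ (Finset.mem_image_of_mem (fun v => (π v, v)) ?_)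
      exact Finset.mem_erase.mpr ⟨fun h => hadj.ne (by rw [h, hx]), hb⟩
  have h1 := (Finset.card_le_card hsub).trans (Finset.card_union_le _ _)
  have h2 := Finset.card_image_le (s := (ball G x j).erase x) (f := fun v => (v, π v))
  have h3 := Finset.card_image_le (s := (ball G x j).erase x) (f := fun v => (π v, v))
  have h4 := Finset.card_erase_add_one (self_mem_ball (G := G) x j)
  omega

/-- All edges touching the ball of radius `j` lie inside the ball of radius `j + 1`, which has fewer
edges than vertices; critical density bounds their number from below. -/
lemma CriticallyDense.ball_succ [DecidableEq W] {δ : ℝ} (hd : CriticallyDense δ G) {k j : ℕ}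
    (hG : HighGirth k G) (hk : 2 * (j + 1) + 1 ≤ k) (x : W) :
    (1 + δ) * (ball G x j).card + 1 ≤ (ball G x (j + 1)).card := by
  classical
  have h1 := hd (ball G x j) ⟨x, self_mem_ball x j⟩
  have h2 := hG.adjPairs_ball hk x
  have h3 : adjPairs G Finset.univ ⊆
      adjPairs G (ball G x j)ᶜ ∪ adjPairs G (ball G x (j + 1)) := by
    rintro ⟨a, b⟩ hab
    have hadj := (mem_adjPairs.mp hab).2
    simp only [Finset.mem_union, mem_adjPairs, Finset.mem_compl] at hadj ⊢
    have ha := fun h => mem_ball_succ_of_adj (x := x) (j := j) (z := b) (y := a) h hadj.symm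
    have hb := fun h => mem_ball_succ_of_adj (x := x) (j := j) (z := a) (y := b) h hadj
    have ha' := @ball_subset_succ W _ G x j a
    have hb' := @ball_subset_succ W _ G x j b
    tauto
  have h4 := (Finset.card_le_card h3).trans (Finset.card_union_le _ _)
  have h4' : ((adjPairs G Finset.univ).card : ℝ) ≤
    (adjPairs G (ball G x j)ᶜ).card + (adjPairs G (ball G x (j + 1))).card := by exact_mod_cast h4
  have h2' : ((adjPairs G (ball G x (j + 1))).card : ℝ) + 2 ≤ 2 * (ball G x (j + 1)).card := by
    exact_mod_cast h2
  linarith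

lemma CriticallyDense.card_ball [DecidableEq W] {δ : ℝ} (hδ : 0 ≤ δ) (hd : CriticallyDense δ G)
    {k : ℕ} (hG : HighGirth k G) (j : ℕ) (hk : 2 * j + 1 ≤ k) (x : W) :
    (1 + δ) ^ (j + 1) ≤ 1 + δ * (ball G x j).card := by
  induction j with
  | zero =>
    have : (1 : ℝ) ≤ (ball G x 0).card := by
      exact_mod_cast Finset.card_pos.mpr ⟨x, self_mem_ball x 0⟩
    rw [zero_add, pow_one]
    linarith [mul_le_mul_of_nonneg_left this hδ]
  | succ j ih =>
    have h1 := ih (by omega)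
    have h2 := hd.ball_succ hG hk x
    have h3 := mul_le_mul_of_nonneg_left h1 (by linarith : 0 ≤ 1 + δ)
    have h4 := mul_le_mul_of_nonneg_left h2 hδ
    rw [pow_succ']
    nlinarith

end Balls

/-! ### Contracting the pieces of a ball packing -/

section Quotient

variable {W : Type*}

/-- The graph on all finite vertex sets, in which sets are adjacent if `G` has an edge between
them. -/
def setGraph (G : SimpleGraph W) : SimpleGraph (Finset W) where
  Adj A B := A ≠ B ∧ ∃ u ∈ A, ∃ v ∈ B, G.Adj u v
  symm := ⟨fun _ _ ⟨h, u, hu, v, hv, huv⟩ => ⟨h.symm, v, hv, u, hu, huv.symm⟩⟩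
  loopless := ⟨fun _ h => h.1 rfl⟩

/-- A family of pairwise disjoint vertex sets that induce connected subgraphs. -/
def IsBranchFamily (G : SimpleGraph W) (F : Finset (Finset W)) : Prop :=
  (∀ A ∈ F, (G.induce (A : Set W)).Connected) ∧ ∀ A ∈ F, ∀ B ∈ F, A ≠ B → Disjoint A B

lemma iterate_fiber_connected {G : SimpleGraph W} {π : W → W}
    (hπ : ∀ y, π y = y ∨ G.Adj y (π y)) (R : ℕ) {z : W} (hz : π z = z) :
    (G.induce {y | π^[R] y = z}).Connected := by
  have hstep : ∀ y, π^[R] y = z → π^[R] (π y) = z := by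
    intro y hy
    rw [← Function.iterate_succ_apply, Function.iterate_succ_apply', hy, hz]
  have hreach : ∀ (i : ℕ) (y : W) (hy : π^[R] y = z) (hy' : π^[R] (π^[i] y) = z),
      (G.induce {y | π^[R] y = z}).Reachable ⟨y, hy⟩ ⟨π^[i] y, hy'⟩ := by
    intro i
    induction i with
    | zero => intro y hy hy'; exact .rfl
    | succ i ih =>
      intro y hy hy'
      have h1 := hstep y hy
      refine SimpleGraph.Reachable.trans ?_ (ih (π y) h1 hy')
      rcases hπ y with h | h
      · have : (⟨y, hy⟩ : {y | π^[R] y = z}) = ⟨π y, h1⟩ := Subtype.ext h.symm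
        rw [this]
      · exact SimpleGraph.Adj.reachable (G := G.induce _) h
  have hzz : π^[R] z = z := Function.iterate_fixed hz R
  rw [SimpleGraph.connected_iff_exists_forall_reachable]
  refine ⟨⟨z, hzz⟩, fun ⟨y, hy⟩ => ?_⟩
  have h := hreach R y hy (by rw [show π^[R] y = z from hy]; exact hzz)
  have h' : (⟨π^[R] y, by rw [Set.mem_ofPred_eq, show π^[R] y = z from hy]; exact hzz⟩ :
    {y | π^[R] y = z}) = ⟨z, hzz⟩ := Subtype.ext hy
  rw [h'] at h
  exact h.symm

variable [Fintype W] [DecidableEq W] {G : SimpleGraph W}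

/-- There are vertices with disjoint balls of radius `r` such that all vertices have distance at
most `2r` from one of them. -/
lemma exists_ball_packing (G : SimpleGraph W) (r : ℕ) :
    ∃ Z : Finset W, (∀ x ∈ Z, ∀ y ∈ Z, x ≠ y → Disjoint (ball G x r) (ball G y r)) ∧
      ∀ x, ∃ z ∈ Z, ∃ w : G.Walk x z, w.length ≤ 2 * r := by
  classical
  obtain ⟨Z, hZ, hmax⟩ := Finset.exists_max_image
    (Finset.univ.filter fun Z : Finset W =>
      ∀ x ∈ Z, ∀ y ∈ Z, x ≠ y → Disjoint (ball G x r) (ball G y r)) Finset.card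
    ⟨∅, by simp⟩
  rw [Finset.mem_filter] at hZ
  refine ⟨Z, hZ.2, fun x => ?_⟩
  by_contra hx
  push Not at hx
  have hdis : ∀ z ∈ Z, Disjoint (ball G x r) (ball G z r) := by
    intro z hz
    rw [Finset.disjoint_left]
    intro y hy hy'
    obtain ⟨w, hw⟩ := mem_ball.mp hy
    obtain ⟨w', hw'⟩ := mem_ball.mp hy'
    have := hx z hz (w.reverse.append w')
    rw [SimpleGraph.Walk.length_append, SimpleGraph.Walk.length_reverse] at this
    omega
  have hxZ : x ∉ Z := fun h => by simpa using hx x h .nil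
  have := hmax (insert x Z) (by
    rw [Finset.mem_filter]
    refine ⟨Finset.mem_univ _, fun a ha b hb hab => ?_⟩
    rcases Finset.mem_insert.mp ha with ha' | ha' <;> rcases Finset.mem_insert.mp hb with hb' | hb'
    · exact absurd (ha'.trans hb'.symm) hab
    · rw [ha']; exact hdis b hb'
    · rw [hb']; exact (hdis a ha').symm
    · exact hZ.2 a ha' b hb' hab)
  rw [Finset.card_insert_of_notMem hxZ] at this
  omega

/-- Contracting pieces of radius at most `2r` in a critically dense graph of large girth gives a
graph of large average degree. -/
theorem CriticallyDense.exists_branchFamily [Nonempty W] {δ : ℝ} (hδ : 0 ≤ δ)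
    (hd : CriticallyDense δ G) {k r : ℕ} (hG : HighGirth k G) (hk : 8 * r + 2 ≤ k) :
    ∃ F : Finset (Finset W), F.Nonempty ∧ IsBranchFamily G F ∧
      2 * (1 + δ) ^ r * F.card ≤ (adjPairs (setGraph G) F).card := by
  classical
  obtain ⟨Z, hZdis, hZcov⟩ := exists_ball_packing G r
  obtain ⟨π, hπZ, hπ, hπi⟩ := exists_parent G (Z : Set W)
  have hroot : ∀ y, π^[2 * r] y ∈ Z := by
    intro y
    obtain ⟨z, hz, hw⟩ := hZcov y
    exact hπi _ y z hz hw
  have hfix : ∀ z ∈ Z, π^[2 * r] z = z := fun z hz => Function.iterate_fixed (hπZ z hz) _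
  let part : W → Finset W := fun z => Finset.univ.filter fun y => π^[2 * r] y = z
  have hpart : ∀ y z, y ∈ part z ↔ π^[2 * r] y = z := fun y z => by simp [part]
  have hinj : Set.InjOn part Z := by
    intro a ha b hb hab
    have : a ∈ part b := hab ▸ (hpart a a).mpr (hfix a ha)
    rw [hpart, hfix a ha] at this
    exact this
  have hFcard : (Z.image part).card = Z.card := Finset.card_image_of_injOn hinj
  -- The balls around `Z` are disjoint and large, so `Z` is small.
  have hpacking : Z.card * (1 + δ) ^ (r + 1) ≤ Z.card + δ * Fintype.card W := by
    have h1 : ∑ z ∈ Z, (ball G z r).card ≤ Fintype.card W := by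
      rw [← Finset.card_biUnion (fun x hx y hy => hZdis x hx y hy)]
      exact Finset.card_le_univ _
    have h2 : ∑ z ∈ Z, (1 + δ) ^ (r + 1) ≤ ∑ z ∈ Z, (1 + δ * (ball G z r).card) :=
      Finset.sum_le_sum fun z _ => hd.card_ball hδ hG r (by omega) z
    rw [Finset.sum_add_distrib, ← Finset.mul_sum, Finset.sum_const, Finset.sum_const, nsmul_eq_mul,
      nsmul_eq_mul, mul_one] at h2
    have h3 : (∑ z ∈ Z, ((ball G z r).card : ℝ)) ≤ Fintype.card W := by exact_mod_cast h1
    linarith [mul_le_mul_of_nonneg_left h3 hδ]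
  refine ⟨Z.image part, ?_, ⟨?_, ?_⟩, ?_⟩
  · exact ⟨_, Finset.mem_image_of_mem part (hroot (Classical.arbitrary W))⟩
  · intro A hA
    obtain ⟨z, hz, rfl⟩ := Finset.mem_image.mp hA
    have : ((part z : Finset W) : Set W) = {y | π^[2 * r] y = z} := by
      ext y; simp [part]
    rw [this]
    exact iterate_fiber_connected hπ _ (hπZ z hz)
  · intro A hA B hB hAB
    obtain ⟨a, ha, rfl⟩ := Finset.mem_image.mp hA
    obtain ⟨b, hb, rfl⟩ := Finset.mem_image.mp hB
    rw [Finset.disjoint_left]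
    intro y hy hy'
    rw [hpart] at hy hy'
    exact hAB (by rw [← hy, ← hy'])
  -- The forest has at most `|W| - |Z|` edges, so at least `δ|W| + |Z|` edges lie outside it. By
  -- `hpacking` this is at least `(1 + δ)^(r + 1) |Z|`, and the girth makes them distinct edges of
  -- the quotient.
  · let N := (adjPairs G Finset.univ).filter fun e => ∀ v, s(e.1, e.2) ≠ s(v, π v)
    have hforest : ((adjPairs G Finset.univ).filter fun e => ¬ ∀ v, s(e.1, e.2) ≠ s(v, π v)) ⊆
        Zᶜ.image (fun v => (v, π v)) ∪ Zᶜ.image (fun v => (π v, v)) := by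
      rintro ⟨a, b⟩ hab
      rw [Finset.mem_filter] at hab
      obtain ⟨hab, hF⟩ := hab
      have hadj : G.Adj a b := (mem_adjPairs.mp hab).2
      push Not at hF
      obtain ⟨v, hv⟩ := hF
      rcases Sym2.eq_iff.mp hv with ⟨h1, h2⟩ | ⟨h1, h2⟩
      · simp only at h1 h2
        subst h1 h2
        refine Finset.mem_union_left _ (Finset.mem_image_of_mem (fun v => (v, π v)) ?_)
        exact Finset.mem_compl.mpr fun h => hadj.ne (hπZ _ h).symm
      · simp only at h1 h2
        subst h1 h2
        refine Finset.mem_union_right _ (Finset.mem_image_of_mem (fun v => (π v, v)) ?_)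
        exact Finset.mem_compl.mpr fun h => hadj.ne (hπZ _ h)
    have h1 := (Finset.card_le_card hforest).trans (Finset.card_union_le _ _)
    have h2 := Finset.card_image_le (s := Zᶜ) (f := fun v => (v, π v))
    have h3 := Finset.card_image_le (s := Zᶜ) (f := fun v => (π v, v))
    have h4 := Finset.card_filter_add_card_filter_not (s := adjPairs G Finset.univ)
      (fun e => ∀ v, s(e.1, e.2) ≠ s(v, π v))
    have h5 : N.card ≤ (adjPairs (setGraph G) (Z.image part)).card := by
      refine Finset.card_le_card_of_injOn
        (fun e => (part (π^[2 * r] e.1), part (π^[2 * r] e.2))) ?_ ?_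
      · rintro ⟨a, b⟩ hab
        obtain ⟨hab, hF⟩ := Finset.mem_filter.mp hab
        have hadj : G.Adj a b := (mem_adjPairs.mp hab).2
        rw [SetLike.mem_coe, mem_adjPairs]
        refine ⟨⟨Finset.mem_image_of_mem _ (hroot a), Finset.mem_image_of_mem _ (hroot b)⟩,
          fun h => ?_, a, (hpart _ _).mpr rfl, b, (hpart _ _).mpr rfl, hadj⟩
        exact hG.iterate_ne (by omega) hπ hadj hF (hinj (hroot a) (hroot b) h)
      · rintro ⟨a, b⟩ hab ⟨a', b'⟩ hab' h
        obtain ⟨hab, hF⟩ := Finset.mem_filter.mp hab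
        obtain ⟨hab', -⟩ := Finset.mem_filter.mp hab'
        have hadj : G.Adj a b := (mem_adjPairs.mp hab).2
        have hadj' : G.Adj a' b' := (mem_adjPairs.mp hab').2
        obtain ⟨h1, h2⟩ := Prod.mk.inj h
        have h1' := hinj (hroot a) (hroot a') h1
        have h2' := hinj (hroot b) (hroot b') h2
        rcases Sym2.eq_iff.mp (hG.edge_unique (R := 2 * r) (by omega) hπ hadj hadj' hF h1' h2') with
          ⟨rfl, rfl⟩ | ⟨rfl, rfl⟩
        · rfl
        · exact absurd h1' (hG.iterate_ne (by omega) hπ hadj hF)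
    have h6 := hd Finset.univ Finset.univ_nonempty
    have h7 : adjPairs G (Finset.univ : Finset W)ᶜ = ∅ := by simp [adjPairs]
    rw [h7, Finset.card_empty, Finset.card_univ] at h6
    have h8 := Finset.card_compl_add_card Z
    have h9 : (adjPairs G Finset.univ).card + 2 * Z.card ≤
        (adjPairs (setGraph G) (Z.image part)).card + 2 * Fintype.card W := by
      simp only [N] at h5
      omega
    have h9' : ((adjPairs G Finset.univ).card : ℝ) + 2 * Z.card ≤
        (adjPairs (setGraph G) (Z.image part)).card + 2 * Fintype.card W := by exact_mod_cast h9
    have h10 : (1 + δ) ^ r * Z.card ≤ (1 + δ) ^ (r + 1) * Z.card :=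
      mul_le_mul_of_nonneg_right (pow_le_pow_right₀ (by linarith) (Nat.le_succ r)) (by positivity)
    rw [hFcard]
    push_cast at h6
    linarith

end Quotient

/-! ### Connectors in a dense graph -/

section DenseGraph

variable {X : Type*}

open Classical in
/-- The neighbours of `x` in `S`. -/
noncomputable def nbrsIn (Q : SimpleGraph X) (S : Finset X) (x : X) : Finset X :=
  S.filter fun y => Q.Adj x y

lemma mem_nbrsIn {Q : SimpleGraph X} {S : Finset X} {x y : X} :
    y ∈ nbrsIn Q S x ↔ y ∈ S ∧ Q.Adj x y := by
  simp [nbrsIn]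

lemma card_adjPairs_eq_sum (Q : SimpleGraph X) (S : Finset X) :
    (adjPairs Q S).card = ∑ x ∈ S, (nbrsIn Q S x).card := by
  classical
  rw [adjPairs, Finset.card_filter, Finset.sum_product]
  refine Finset.sum_congr rfl fun x _ => ?_
  rw [nbrsIn, Finset.card_filter]

lemma card_nbrsIn_insert [DecidableEq X] (Q : SimpleGraph X) {S : Finset X} {x : X} (hx : x ∉ S)
    (y : X) [Decidable (Q.Adj y x)] : (nbrsIn Q (insert x S) y).card =
      (nbrsIn Q S y).card + if Q.Adj y x then 1 else 0 := by
  classical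
  rw [nbrsIn, nbrsIn, Finset.filter_insert]
  split_ifs
  · rw [Finset.card_insert_of_notMem (by simp [hx])]
  · rfl

lemma card_adjPairs_insert [DecidableEq X] (Q : SimpleGraph X) {S : Finset X} {x : X}
    (hx : x ∉ S) :
    (adjPairs Q (insert x S)).card = (adjPairs Q S).card + 2 * (nbrsIn Q S x).card := by
  classical
  rw [card_adjPairs_eq_sum, Finset.sum_insert hx, card_nbrsIn_insert Q hx, if_neg (Q.loopless.irrefl x),
    Finset.sum_congr rfl fun y _ => card_nbrsIn_insert Q hx y, Finset.sum_add_distrib,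
    ← card_adjPairs_eq_sum, ← Finset.card_filter]
  have : S.filter (fun y => Q.Adj y x) = nbrsIn Q S x := by
    ext y; simp [mem_nbrsIn, Q.adj_comm]
  rw [this]
  ring

lemma exists_max_card_subset (M : Finset X) {P : Finset X → Prop} (h : P ∅) :
    ∃ I ⊆ M, P I ∧ ∀ J ⊆ M, P J → J.card ≤ I.card := by
  classical
  obtain ⟨I, hI, hmax⟩ := Finset.exists_max_image (M.powerset.filter P) Finset.card
    ⟨∅, by simpa using h⟩
  simp only [Finset.mem_filter, Finset.mem_powerset] at hI hmax
  exact ⟨I, hI.1, hI.2, fun J hJM hJ => hmax J ⟨hJM, hJ⟩⟩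

open Classical in
/-- In a graph in which all vertices are adjacent to about half of the vertices, there are `t`
vertices and distinct common neighbours of any two of them. -/
theorem exists_connectors (Q : SimpleGraph X) {M : Finset X} {t : ℕ} (ht : 1 ≤ t)
    (hM : 18 * t ^ 2 < M.card) (hdeg : ∀ x ∈ M, M.card ≤ 2 * (nbrsIn Q M x).card + 2) :
    ∃ (u : Fin t → X) (c : Fin t → Fin t → X), Function.Injective u ∧ (∀ i, u i ∈ M) ∧
      (∀ i j, i ≠ j → c i j ∈ M ∧ Q.Adj (u i) (c i j) ∧ Q.Adj (u j) (c i j) ∧ ∀ l, c i j ≠ u l) ∧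
      ∀ i j i' j', i ≠ j → i' ≠ j' → c i j = c i' j' → i = i' := by
  let bad : X → X → Prop := fun x y => (nbrsIn Q M x ∩ nbrsIn Q M y).card < t ^ 2 + t
  have hsymm : ∀ x y, bad x y → bad y x := fun x y h => by
    simp only [bad] at h ⊢; rwa [Finset.inter_comm]
  have htt : t ≤ t ^ 2 := by nlinarith
  -- Three neighbourhoods of size at least `|M|/2 - 1` with small pairwise intersections do not fit
  -- into `M`. So the bad pairs form a triangle-free graph.
  have hthree : ∀ x ∈ M, ∀ y ∈ M, ∀ z ∈ M, bad x y → bad x z → ¬ bad y z := by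
    intro x hx y hy z hz hxy hxz hyz
    have h1 := Finset.card_union_add_card_inter (nbrsIn Q M x) (nbrsIn Q M y)
    have h2 := Finset.card_union_add_card_inter (nbrsIn Q M x ∪ nbrsIn Q M y) (nbrsIn Q M z)
    have h3 : (nbrsIn Q M x ∪ nbrsIn Q M y ∪ nbrsIn Q M z).card ≤ M.card :=
      Finset.card_le_card (Finset.union_subset (Finset.union_subset (Finset.filter_subset _ _)
        (Finset.filter_subset _ _)) (Finset.filter_subset _ _))
    have h4 := Finset.card_union_le (nbrsIn Q M x ∩ nbrsIn Q M z) (nbrsIn Q M y ∩ nbrsIn Q M z)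
    rw [← Finset.union_inter_distrib_right] at h4
    have := hdeg x hx
    have := hdeg y hy
    have := hdeg z hz
    simp only [bad] at hxy hxz hyz
    omega
  obtain ⟨I, hIM, hI, hmax⟩ := exists_max_card_subset M
    (P := fun I => ∀ x ∈ I, ∀ y ∈ I, x ≠ y → ¬ bad x y) (by simp)
  -- If `I` were small, pigeonhole would give more than `t` vertices bad with one `u ∈ I`. By
  -- triangle-freeness no two of them are bad, against the maximality of `I`.
  have hIt : t ≤ I.card := by
    by_contra hlt
    push Not at hlt
    have hex : ∀ x, ∃ u, x ∈ M \ I → u ∈ I ∧ bad u x := by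
      intro x
      by_cases hx : x ∈ M \ I
      · obtain ⟨hxM, hxI⟩ := Finset.mem_sdiff.mp hx
        by_contra hcon
        push Not at hcon
        have hgood : ∀ u ∈ I, ¬ bad u x := fun u hu => (hcon u).2 hu
        have := hmax (insert x I) (Finset.insert_subset hxM hIM) (by
          intro a ha b hb hab
          rcases Finset.mem_insert.mp ha with ha' | ha' <;>
            rcases Finset.mem_insert.mp hb with hb' | hb'
          · exact absurd (ha'.trans hb'.symm) hab
          · rw [ha']; exact fun h => hgood b hb' (hsymm _ _ h)
          · rw [hb']; exact hgood a ha'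
          · exact hI a ha' b hb' hab)
        rw [Finset.card_insert_of_notMem hxI] at this
        omega
      · exact ⟨x, fun h => absurd h hx⟩
    choose f hf using hex
    have hcard := Finset.le_card_sdiff I M
    have hlt' : I.card * t < (M \ I).card := by
      have : I.card * t ≤ t * t := Nat.mul_le_mul_right _ hlt.le
      have h2 : t ^ 2 = t * t := sq t
      omega
    obtain ⟨u, hu, hfib⟩ := Finset.exists_lt_card_fiber_of_mul_lt_card_of_maps_to
      (fun x hx => (hf x hx).1) hlt'
    have hsub : ∀ x ∈ (M \ I).filter (fun x => f x = u), x ∈ M ∧ bad u x := by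
      intro x hx
      obtain ⟨hx', rfl⟩ := Finset.mem_filter.mp hx
      exact ⟨(Finset.mem_sdiff.mp hx').1, (hf x hx').2⟩
    have := hmax ((M \ I).filter fun x => f x = u) (fun x hx => (hsub x hx).1)
      fun x hx y hy _ =>
        hthree u (hIM hu) x (hsub x hx).1 y (hsub y hy).1 (hsub x hx).2 (hsub y hy).2
    omega
  obtain ⟨U, hUI, hUt⟩ := Finset.exists_subset_card_eq hIt
  let e := (U.equivFinOfCardEq hUt).symm
  let ι := {p : Fin t × Fin t // p.1 ≠ p.2}
  let S : ι → Finset X := fun p =>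
    (nbrsIn Q M (e p.1.1) ∩ nbrsIn Q M (e p.1.2)) \ U
  have hS : ∀ p : ι, Fintype.card ι ≤ (S p).card := by
    intro p
    have h1 : Fintype.card ι ≤ t ^ 2 := by
      refine (Fintype.card_subtype_le _).trans ?_
      rw [Fintype.card_prod, Fintype.card_fin, sq]
    have h2 := Finset.le_card_sdiff U (nbrsIn Q M (e p.1.1) ∩ nbrsIn Q M (e p.1.2))
    have h3 : ¬ bad (e p.1.1) (e p.1.2) :=
      hI _ (hUI (e p.1.1).2) _ (hUI (e p.1.2).2)
        fun h => p.2 (e.injective (Subtype.ext h))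
    simp only [bad] at h3
    simp only [S]
    omega
  -- Hall's condition is immediate: every candidate set is at least as large as the number of pairs.
  obtain ⟨c, hc, hcS⟩ := (Finset.all_card_le_biUnion_card_iff_exists_injective S).mp (by
    intro s
    rcases s.eq_empty_or_nonempty with rfl | ⟨p, hp⟩
    · simp
    · exact ((Finset.card_le_univ s).trans (hS p)).trans
        (Finset.card_le_card (Finset.subset_biUnion_of_mem S hp)))
  refine ⟨fun i => e i, fun i j => if h : i ≠ j then c ⟨(i, j), h⟩ else e i, ?_, ?_, ?_, ?_⟩
  · exact fun i j h => e.injective (Subtype.ext h)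
  · exact fun i => hIM (hUI (e i).2)
  · intro i j hij
    simp only [dif_pos hij]
    have := hcS ⟨(i, j), hij⟩
    simp only [S, Finset.mem_sdiff, Finset.mem_inter, mem_nbrsIn] at this
    exact ⟨this.1.1.1, this.1.1.2, this.1.2.2, fun l h => this.2 (h ▸ (e l).2)⟩
  · intro i j i' j' hij hij' h
    simp only [dif_pos hij, dif_pos hij'] at h
    have := hc h
    rw [Subtype.mk.injEq, Prod.mk.injEq] at this
    exact this.1

end DenseGraph

/-! ### Clique minors from large average degree -/

section Contraction

variable {W : Type*} {G : SimpleGraph W}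

lemma induce_union_connected_of_setGraph_adj [DecidableEq W] {A B : Finset W}
    (hA : (G.induce (A : Set W)).Connected) (hB : (G.induce (B : Set W)).Connected)
    (h : (setGraph G).Adj A B) : (G.induce ((A ∪ B : Finset W) : Set W)).Connected := by
  obtain ⟨-, u, hu, v, hv, huv⟩ := h
  rw [Finset.coe_union]
  exact SimpleGraph.connected_induce_union hA.preconnected hB.preconnected hu hv huv

/-- A branch family of maximal average degree. -/
lemma exists_densest_branchFamily [Fintype W] {F₀ : Finset (Finset W)} (hF₀ : F₀.Nonempty)
    (hB : IsBranchFamily G F₀) {d : ℝ}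
    (hd : d * F₀.card ≤ (adjPairs (setGraph G) F₀).card) :
    ∃ (F : Finset (Finset W)) (c : ℝ), F.Nonempty ∧ IsBranchFamily G F ∧ d ≤ c ∧
      (adjPairs (setGraph G) F).card = c * F.card ∧
      ∀ F', IsBranchFamily G F' → (adjPairs (setGraph G) F').card ≤ c * F'.card := by
  classical
  obtain ⟨F, hF, hmax⟩ := Finset.exists_max_image
    (Finset.univ.filter fun F : Finset (Finset W) => F.Nonempty ∧ IsBranchFamily G F)
    (fun F => ((adjPairs (setGraph G) F).card : ℝ) / F.card) ⟨F₀, by simp [hF₀, hB]⟩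
  simp only [Finset.mem_filter, Finset.mem_univ, true_and] at hF hmax
  have hpos : ∀ F : Finset (Finset W), F.Nonempty → (0 : ℝ) < F.card := fun F hF => by
    exact_mod_cast hF.card_pos
  refine ⟨F, _, hF.1, hF.2, ?_, (div_mul_cancel₀ _ (hpos F hF.1).ne').symm, ?_⟩
  · exact ((le_div_iff₀ (hpos F₀ hF₀)).mpr hd).trans (hmax F₀ ⟨hF₀, hB⟩)
  · intro F' hF'
    rcases F'.eq_empty_or_nonempty with rfl | hne
    · simp [adjPairs]
    · exact (div_le_iff₀ (hpos F' hne)).mp (hmax F' ⟨hne, hF'⟩)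

lemma IsBranchFamily.mono {F F' : Finset (Finset W)} (h : IsBranchFamily G F) (hF : F' ⊆ F) :
    IsBranchFamily G F' :=
  ⟨fun A hA => h.1 A (hF hA), fun A hA B hB => h.2 A (hF hA) B (hF hB)⟩

lemma IsBranchFamily.nonempty {F : Finset (Finset W)} (h : IsBranchFamily G F) {A : Finset W}
    (hA : A ∈ F) : A.Nonempty := by
  obtain ⟨⟨x, hx⟩⟩ := (h.1 A hA).nonempty
  exact ⟨x, hx⟩

/-- In a densest branch family, all sets have large degree. -/
lemma le_card_nbrsIn_of_densest {F : Finset (Finset W)} {c : ℝ} (hF : IsBranchFamily G F)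
    (hc : (adjPairs (setGraph G) F).card = c * F.card)
    (hmax : ∀ F', IsBranchFamily G F' → (adjPairs (setGraph G) F').card ≤ c * F'.card)
    {A : Finset W} (hA : A ∈ F) : c ≤ 2 * (nbrsIn (setGraph G) F A).card := by
  classical
  have h1 := card_adjPairs_insert (setGraph G) (Finset.notMem_erase A F)
  have h2 := card_nbrsIn_insert (setGraph G) (Finset.notMem_erase A F) A
  rw [if_neg ((setGraph G).loopless.irrefl A), Finset.insert_erase hA] at h2
  rw [Finset.insert_erase hA, ← Nat.add_zero (nbrsIn _ _ _).card, ← h2] at h1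
  have h3 := hmax _ (hF.mono (Finset.erase_subset A F))
  have h4 : ((F.erase A).card : ℝ) + 1 = F.card := by
    exact_mod_cast Finset.card_erase_add_one hA
  have h5 : ((adjPairs (setGraph G) F).card : ℝ) = (adjPairs (setGraph G) (F.erase A)).card +
    2 * (nbrsIn (setGraph G) F A).card := by exact_mod_cast h1
  rw [← h4] at hc
  linarith

/-- In a densest branch family, adjacent sets have many common neighbours. -/
lemma le_card_common_of_densest {F : Finset (Finset W)} {c : ℝ} (hF : IsBranchFamily G F)
    (hc : (adjPairs (setGraph G) F).card = c * F.card)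
    (hmax : ∀ F', IsBranchFamily G F' → (adjPairs (setGraph G) F').card ≤ c * F'.card)
    {A B : Finset W} (hA : A ∈ F) (hB : B ∈ F) (hAB : (setGraph G).Adj A B) :
    c ≤ 2 * (nbrsIn (setGraph G) (nbrsIn (setGraph G) F A) B).card + 2 := by
  classical
  set Q := setGraph G with hQ
  have hne : A ≠ B := hAB.ne
  set R := (F.erase A).erase B with hR
  have hBA : B ∈ F.erase A := Finset.mem_erase.mpr ⟨hne.symm, hB⟩
  have hRB : B ∉ R := Finset.notMem_erase _ _
  have hAR : A ∉ insert B R := by rw [hR, Finset.insert_erase hBA]; exact Finset.notMem_erase _ _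
  have hFR : F = insert A (insert B R) := by
    rw [hR, Finset.insert_erase hBA, Finset.insert_erase hA]
  have hRF : R ⊆ F := (Finset.erase_subset _ _).trans (Finset.erase_subset _ _)
  have hRdis : ∀ C ∈ R, Disjoint C A ∧ Disjoint C B := by
    intro C hC
    obtain ⟨h1, h2⟩ := Finset.mem_erase.mp hC
    obtain ⟨h3, h4⟩ := Finset.mem_erase.mp h2
    exact ⟨hF.2 C h4 A hA h3, hF.2 C h4 B hB h1⟩
  have hUR : A ∪ B ∉ R := by
    intro h
    obtain ⟨x, hx⟩ := hF.nonempty hA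
    exact Finset.disjoint_left.mp (hRdis _ h).1 (Finset.mem_union_left _ hx) hx
  have hF' : IsBranchFamily G (insert (A ∪ B) R) := by
    refine ⟨fun C hC => ?_, fun C hC D hD hCD => ?_⟩
    · rcases Finset.mem_insert.mp hC with rfl | hC
      · exact induce_union_connected_of_setGraph_adj (hF.1 A hA) (hF.1 B hB) hAB
      · exact hF.1 C (hRF hC)
    · rcases Finset.mem_insert.mp hC with hC' | hC' <;>
        rcases Finset.mem_insert.mp hD with hD' | hD'
      · exact absurd (hC'.trans hD'.symm) hCD
      · rw [hC']
        exact Finset.disjoint_union_left.mpr ⟨(hRdis D hD').1.symm, (hRdis D hD').2.symm⟩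
      · rw [hD']
        exact Finset.disjoint_union_right.mpr (hRdis C hC')
      · exact hF.2 C (hRF hC') D (hRF hD') hCD
  -- Merging `A` and `B` loses the edge between them and one edge per common neighbour, while the
  -- number of sets drops by one. As the average cannot rise, there are about `c/2` common
  -- neighbours.
  have h1 : (adjPairs Q F).card = (adjPairs Q R).card + 2 * (nbrsIn Q R B).card +
      2 * ((nbrsIn Q R A).card + 1) := by
    rw [hFR, card_adjPairs_insert Q hAR, card_adjPairs_insert Q hRB, card_nbrsIn_insert Q hRB,
      if_pos hAB]
  have h2 := card_adjPairs_insert Q hUR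
  have h3 : (nbrsIn Q R A ∪ nbrsIn Q R B).card ≤ (nbrsIn Q R (A ∪ B)).card := by
    refine Finset.card_le_card fun C hC => ?_
    have hCR : C ∈ R := by
      rcases Finset.mem_union.mp hC with h | h <;> exact (mem_nbrsIn.mp h).1
    refine mem_nbrsIn.mpr ⟨hCR, fun h => hUR (h ▸ hCR), ?_⟩
    rcases Finset.mem_union.mp hC with h | h
    · obtain ⟨-, -, u, hu, v, hv, huv⟩ := mem_nbrsIn.mp h
      exact ⟨u, Finset.mem_union_left _ hu, v, hv, huv⟩
    · obtain ⟨-, -, u, hu, v, hv, huv⟩ := mem_nbrsIn.mp h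
      exact ⟨u, Finset.mem_union_right _ hu, v, hv, huv⟩
  have h4 := Finset.card_union_add_card_inter (nbrsIn Q R A) (nbrsIn Q R B)
  have h5 : (nbrsIn Q R A ∩ nbrsIn Q R B).card ≤ (nbrsIn Q (nbrsIn Q F A) B).card := by
    refine Finset.card_le_card fun C hC => ?_
    simp only [Finset.mem_inter, mem_nbrsIn] at hC ⊢
    exact ⟨⟨hRF hC.1.1, hC.1.2⟩, hC.2.2⟩
  have h6 := hmax _ hF'
  have h7 : F.card = R.card + 2 := by
    rw [hFR, Finset.card_insert_of_notMem hAR, Finset.card_insert_of_notMem hRB]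
  rw [Finset.card_insert_of_notMem hUR] at h6
  have h8 : (adjPairs Q F).card ≤ (adjPairs Q (insert (A ∪ B) R)).card + 2 +
      2 * (nbrsIn Q (nbrsIn Q F A) B).card := by omega
  have h8' : ((adjPairs Q F).card : ℝ) ≤ (adjPairs Q (insert (A ∪ B) R)).card + 2 +
      2 * (nbrsIn Q (nbrsIn Q F A) B).card := by exact_mod_cast h8
  rw [hc, h7] at h8'
  push_cast at h6 h8'
  linarith

lemma induce_star_connected {V ι : Type*} {G : SimpleGraph V} {A : Set V} {C : ι → Set V}
    (hA : (G.induce A).Connected) (hC : ∀ i, (G.induce (C i)).Connected)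
    (hAC : ∀ i, ∃ u ∈ A, ∃ v ∈ C i, G.Adj u v) : (G.induce (A ∪ ⋃ i, C i)).Connected := by
  obtain ⟨⟨a, ha⟩⟩ := hA.nonempty
  refine SimpleGraph.induce_connected_of_patches a (.inl ha) ?_
  rintro v (hv | hv)
  · exact ⟨A, Set.subset_union_left, ha, hv, hA.preconnected _ _⟩
  · obtain ⟨i, hi⟩ := Set.mem_iUnion.mp hv
    obtain ⟨x, hx, y, hy, hxy⟩ := hAC i
    exact ⟨A ∪ C i, Set.union_subset_union_right _ (Set.subset_iUnion C i), .inl ha, .inr hi,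
      (SimpleGraph.connected_induce_union hA.preconnected (hC i).preconnected
        hx hy hxy).preconnected _ _⟩

/-- A graph that can be contracted to a graph of large average degree has a large clique minor. -/
theorem hasCliqueMinor_of_branchFamily [Fintype W] {F₀ : Finset (Finset W)} (hF₀ : F₀.Nonempty)
    (hB : IsBranchFamily G F₀) {t : ℕ} (ht : 1 ≤ t) {d : ℝ} (htd : 18 * (t : ℝ) ^ 2 < d)
    (hd : 2 * d * F₀.card ≤ (adjPairs (setGraph G) F₀).card) : HasCliqueMinor G t := by
  classical
  obtain ⟨F, c, hFne, hF, hdc, hc, hmax⟩ := exists_densest_branchFamily hF₀ hB hd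
  -- As `c` is the average degree, some `A` has at most `c` neighbours. Each neighbour of `A` shares
  -- at least `c/2 - 1 ≥ |M|/2 - 1` of them.
  obtain ⟨A, hA, hAc⟩ : ∃ A ∈ F, ((nbrsIn (setGraph G) F A).card : ℝ) ≤ c := by
    refine Finset.exists_le_of_sum_le hFne ?_
    rw [Finset.sum_const, nsmul_eq_mul, mul_comm, ← hc, card_adjPairs_eq_sum]
    push_cast; rfl
  set M := nbrsIn (setGraph G) F A with hM
  have hMF : M ⊆ F := Finset.filter_subset _ _
  have h1 := le_card_nbrsIn_of_densest hF hc hmax hA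
  have hMt : 18 * t ^ 2 < M.card := by
    have : (18 * (t : ℝ) ^ 2) < M.card := by linarith
    exact_mod_cast this
  obtain ⟨u, w, hu, huM, hw, hwinj⟩ := exists_connectors (setGraph G) ht hMt (by
    intro B hB
    have h2 := le_card_common_of_densest hF hc hmax hA (hMF hB) (mem_nbrsIn.mp hB).2
    have h3 : (M.card : ℝ) ≤ 2 * (nbrsIn (setGraph G) M B).card + 2 := by linarith
    exact_mod_cast h3)
  have hdis : ∀ C ∈ M, ∀ D ∈ M, C ≠ D → Disjoint (C : Set W) (D : Set W) := fun C hC D hD h =>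
    Finset.disjoint_coe.mpr (hF.2 C (hMF hC) D (hMF hD) h)
  -- The `i`-th branch set absorbs every connector `w i j`, which is also adjacent to `u j`.
  refine ⟨fun i => (u i : Set W) ∪ ⋃ j : {j // i ≠ j}, (w i j : Set W), ?_, ?_, ?_⟩
  · intro i
    exact induce_star_connected (hF.1 _ (hMF (huM i))) (fun j => hF.1 _ (hMF (hw i j j.2).1))
      fun j => (hw i j j.2).2.1.2
  · intro i j hij
    simp only [Set.disjoint_union_left, Set.disjoint_union_right, Set.disjoint_iUnion_left,
      Set.disjoint_iUnion_right]
    refine ⟨⟨?_, ?_⟩, ?_⟩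
    · exact hdis _ (huM i) _ (huM j) (hu.ne hij)
    · exact fun l => hdis _ (hw i l l.2).1 _ (huM j) ((hw i l l.2).2.2.2 j)
    · intro l
      refine ⟨hdis _ (huM i) _ (hw j l l.2).1 ((hw j l l.2).2.2.2 i).symm, fun l' => ?_⟩
      exact hdis _ (hw i l' l'.2).1 _ (hw j l l.2).1 fun h => hij (hwinj _ _ _ _ l'.2 l.2 h)
  · intro i j hij
    obtain ⟨-, x, hx, y, hy, hxy⟩ := (hw i j hij).2.2.1
    exact ⟨y, .inr (Set.mem_iUnion.mpr ⟨⟨j, hij⟩, hy⟩), x, .inl hx, hxy.symm⟩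

end Contraction

/-! ### From many edges and large girth to a clique minor -/

section Girth

variable {V : Type*} {G : SimpleGraph V}

lemma HighGirth.induce {k : ℕ} (hG : HighGirth k G) (s : Set V) : HighGirth k (G.induce s) := by
  intro v c hc
  have := hG _ (c.map (SimpleGraph.Embedding.induce s).toHom)
    ((SimpleGraph.Walk.isCycle_map_iff_of_injective Subtype.val_injective).mpr hc)
  rwa [SimpleGraph.Walk.length_map] at this

lemma HasCliqueMinor.of_induce {s : Set V} {t : ℕ} (h : HasCliqueMinor (G.induce s) t) :
    HasCliqueMinor G t := by
  obtain ⟨B, hconn, hdisj, hadj⟩ := h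
  refine ⟨fun i => Subtype.val '' B i, fun i => ?_, fun i j hij => ?_, fun i j hij => ?_⟩
  · let f : (G.induce s).induce (B i) →g G.induce (Subtype.val '' B i) :=
      { toFun := fun x => ⟨x.1.1, x.1, x.2, rfl⟩
        map_rel' := fun h => h }
    refine (hconn i).map f ?_
    rintro ⟨_, x, hx, rfl⟩
    exact ⟨⟨x, hx⟩, rfl⟩
  · exact (Set.disjoint_image_iff Subtype.val_injective).mpr (hdisj i j hij)
  · obtain ⟨u, hu, v, hv, huv⟩ := hadj i j hij
    exact ⟨u, ⟨u, hu, rfl⟩, v, ⟨v, hv, rfl⟩, huv⟩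

lemma HasCliqueMinor.mono {H : SimpleGraph V} (hGH : G ≤ H) {t : ℕ} (h : HasCliqueMinor G t) :
    HasCliqueMinor H t := by
  obtain ⟨B, hconn, hdisj, hadj⟩ := h
  refine ⟨B, fun i => (hconn i).mono fun _ _ h => hGH h, hdisj, fun i j hij => ?_⟩
  obtain ⟨u, hu, v, hv, huv⟩ := hadj i j hij
  exact ⟨u, hu, v, hv, hGH huv⟩

lemma card_adjPairs_induce (G : SimpleGraph V) (s : Set V) (T : Finset s) :
    (adjPairs (G.induce s) T).card =
      (adjPairs G (T.map (Function.Embedding.subtype _))).card := by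
  classical
  rw [← Finset.card_map ((Function.Embedding.subtype (· ∈ s)).prodMap
    (Function.Embedding.subtype (· ∈ s)))]
  congr 1
  ext ⟨a, b⟩
  simp only [Finset.mem_map, mem_adjPairs]
  constructor
  · rintro ⟨⟨x, y⟩, ⟨⟨hx, hy⟩, hxy⟩, h⟩
    obtain ⟨rfl, rfl⟩ := Prod.mk.inj h
    exact ⟨⟨⟨x, hx, rfl⟩, ⟨y, hy, rfl⟩⟩, hxy⟩
  · rintro ⟨⟨⟨x, hx, rfl⟩, ⟨y, hy, rfl⟩⟩, hxy⟩
    exact ⟨(x, y), ⟨⟨hx, hy⟩, hxy⟩, rfl⟩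

/-- A graph with many edges has a critically dense induced subgraph. -/
lemma exists_criticallyDense_induce [Fintype V] [Nonempty V] {δ : ℝ}
    (h : 2 * (1 + δ) * Fintype.card V ≤ (adjPairs G Finset.univ).card) :
    ∃ U : Finset V, U.Nonempty ∧
      ∀ [DecidableEq (U : Set V)], CriticallyDense δ (G.induce (U : Set V)) := by
  classical
  -- In a smallest dense vertex set `U`, removing `S` leaves a set that is empty or too sparse, so
  -- many edges are lost.
  obtain ⟨U, hU, hmin⟩ := Finset.exists_min_image
    (Finset.univ.filter fun U : Finset V =>
      U.Nonempty ∧ 2 * (1 + δ) * U.card ≤ (adjPairs G U).card) Finset.card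
    ⟨Finset.univ, by simpa using h⟩
  simp only [Finset.mem_filter, Finset.mem_univ, true_and] at hU hmin
  refine ⟨U, hU.1, ?_⟩
  intro _ S hS
  rw [card_adjPairs_induce, card_adjPairs_induce]
  have huniv : (Finset.univ : Finset (U : Set V)).map (Function.Embedding.subtype _) = U := by
    ext x; simp
  rw [huniv]
  have hcard : S.card + (Sᶜ.map (Function.Embedding.subtype (· ∈ (U : Set V)))).card = U.card := by
    rw [Finset.card_map, Finset.card_add_card_compl]
    simp
  have hcard' : (S.card : ℝ) + (Sᶜ.map (Function.Embedding.subtype (· ∈ (U : Set V)))).card =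
    U.card := by exact_mod_cast hcard
  have hU2 := hU.2
  rw [← hcard', mul_add] at hU2
  refine le_trans ((add_le_add_iff_left _).mpr ?_) hU2
  by_contra hlt
  push Not at hlt
  have hne : (Sᶜ.map (Function.Embedding.subtype (· ∈ (U : Set V)))).Nonempty := by
    rw [Finset.nonempty_iff_ne_empty]
    intro h0
    rw [h0] at hlt
    simp [adjPairs] at hlt
  have := hmin _ ⟨hne, hlt.le⟩
  have := hS.card_pos
  omega

/-- A graph of large girth with more than `(1 + δ) |V|` edges has a large clique minor. -/
theorem HighGirth.hasCliqueMinor [Fintype V] [Nonempty V] {δ : ℝ} (hδ : 0 ≤ δ) {k r t : ℕ}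
    (hG : HighGirth k G) (hk : 8 * r + 2 ≤ k)
    (h : 2 * (1 + δ) * Fintype.card V ≤ (adjPairs G Finset.univ).card) (ht : 1 ≤ t)
    (htr : 18 * (t : ℝ) ^ 2 < (1 + δ) ^ r) : HasCliqueMinor G t := by
  classical
  obtain ⟨U, ⟨x, hx⟩, hcrit⟩ := exists_criticallyDense_induce h
  have : Nonempty (U : Set V) := ⟨⟨x, hx⟩⟩
  obtain ⟨F, hF, hB, hFd⟩ := hcrit.exists_branchFamily hδ (hG.induce _) hk
  exact (hasCliqueMinor_of_branchFamily hF hB ht htr hFd).of_induce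

lemma HasCliqueMinor.anti {s t : ℕ} (hst : s ≤ t) (h : HasCliqueMinor G t) :
    HasCliqueMinor G s := by
  obtain ⟨B, hconn, hdisj, hadj⟩ := h
  have hinj := Fin.castLE_injective hst
  exact ⟨fun i => B (Fin.castLE hst i), fun i => hconn _, fun i j hij => hdisj _ _ (hinj.ne hij),
    fun i j hij => hadj _ _ (hinj.ne hij)⟩

lemma hasCliqueMinor_two_of_adj {u v : V} (h : G.Adj u v) : HasCliqueMinor G 2 := by
  refine ⟨fun i => {if i = 0 then u else v}, fun i => ?_, fun i j hij => ?_, fun i j hij => ?_⟩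
  · exact ⟨SimpleGraph.Preconnected.of_subsingleton⟩
  · rw [Set.disjoint_singleton]
    have := h.ne
    fin_cases i <;> fin_cases j <;> simp_all [eq_comm]
  · refine ⟨_, rfl, _, rfl, ?_⟩
    have := h.symm
    fin_cases i <;> fin_cases j <;> simp_all

end Girth

/-! ### Choice of parameters -/

section Numerics

lemma two_mul_card_le_card_adjPairs {n : ℕ} {H : Finset (Sym2 (Fin n))}
    (hH : H ⊆ completeBoard n) :
    2 * H.card ≤ (adjPairs (graphOf H) Finset.univ).card := by
  classical
  have h1 : (graphOf H).edgeFinset = H := by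
    ext e
    rw [SimpleGraph.mem_edgeFinset, graphOf, SimpleGraph.edgeSet_fromEdgeSet]
    constructor
    · exact fun h => h.1
    · intro he
      have := hH he
      rw [completeBoard, SimpleGraph.mem_edgeFinset, SimpleGraph.edgeSet_top] at this
      exact ⟨he, this⟩
  have h2 := (graphOf H).sum_degrees_eq_twice_card_edges
  rw [h1] at h2
  rw [card_adjPairs_eq_sum, ← h2]
  refine Finset.sum_le_sum fun x _ => ?_
  rw [← SimpleGraph.card_neighborFinset_eq_degree]
  exact Finset.card_le_card fun y hy => mem_nbrsIn.mpr ⟨Finset.mem_univ _, by simpa using hy⟩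

lemma exp_half_le_one_add {δ : ℝ} (h0 : 0 ≤ δ) (h1 : δ ≤ 1) : Real.exp (δ / 2) ≤ 1 + δ := by
  have h2 := Real.one_sub_le_exp_neg (δ / 2)
  rw [Real.exp_neg] at h2
  have h3 := Real.exp_pos (δ / 2)
  have h4 : (1 - δ / 2) * Real.exp (δ / 2) ≤ 1 := by
    calc _ ≤ (Real.exp (δ / 2))⁻¹ * Real.exp (δ / 2) := mul_le_mul_of_nonneg_right h2 h3.le
      _ = 1 := inv_mul_cancel₀ h3.ne'
  nlinarith [mul_nonneg h0 (sub_nonneg.mpr h1)]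

lemma sum_Icc_pow_le {a : ℝ} (h0 : 0 ≤ a) (h3 : a ≤ 3) (k : ℕ) :
    ∑ j ∈ Finset.Icc 3 k, a ^ j ≤ 3 ^ (k + 1) / 2 := by
  have h1 : ∑ j ∈ Finset.Icc 3 k, a ^ j ≤ ∑ j ∈ Finset.range (k + 1), (3 : ℝ) ^ j := by
    calc _ ≤ ∑ j ∈ Finset.Icc 3 k, (3 : ℝ) ^ j :=
          Finset.sum_le_sum fun j _ => pow_le_pow_left₀ h0 h3 j
      _ ≤ _ := by
          refine Finset.sum_le_sum_of_subset_of_nonneg (fun j hj => ?_) fun _ _ _ => by positivity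
          rw [Finset.mem_Icc] at hj
          exact Finset.mem_range.mpr (by omega)
  rw [geom_sum_eq (by norm_num)] at h1
  linarith

theorem clientCanBuild_hasCliqueMinor_two {n : ℕ} (hn : 2 ≤ n) (q : ℕ) :
    ClientCanBuild q (completeBoard n) (fun E => HasCliqueMinor (graphOf E) 2) := by
  refine clientCanBuild_of_invariant (fun _ _ => True) ?_ trivial ?_ ?_
  · refine ⟨s(⟨0, by omega⟩, ⟨1, by omega⟩), ?_⟩
    simp [completeBoard]
  · rintro E hE ⟨e, he⟩ -
    have h := hE he
    induction e with | _ u v =>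
    simp only [completeBoard, SimpleGraph.mem_edgeFinset, SimpleGraph.mem_edgeSet,
      SimpleGraph.top_adj] at h
    exact hasCliqueMinor_two_of_adj (u := u) (v := v) (by
      rw [graphOf, SimpleGraph.fromEdgeSet_adj]; exact ⟨he, h⟩)
  · rintro D E O - ⟨x, hx⟩ - -
    exact ⟨x, hx, trivial⟩

/-- For `y = (ε n) ^ (ε / 10000) > 2`, the length scale `r` of the contraction. -/
lemma exists_radius {ε x : ℝ} (hε : 0 < ε) (hε2 : ε ≤ 1 / 2) (hx : 0 < x)
    (hy : 2 < x ^ (1 / 10000 * ε)) :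
    6 ≤ x ∧ ∃ r : ℕ, (3 : ℝ) ^ (8 * r + 3) ≤ x ∧
      18 * (⌈x ^ (1 / 10000 * ε)⌉₊ : ℝ) ^ 2 < (1 + ε / 4) ^ r := by
  set y := x ^ (1 / 10000 * ε) with hydef
  set L := Real.log x with hL
  have hxL : Real.exp L = x := Real.exp_log hx
  have hyL : y = Real.exp (L * (1 / 10000 * ε)) := Real.rpow_def_of_pos hx _
  have hεL : 1 / 2 < L * (1 / 10000 * ε) := by
    by_contra h
    push Not at h
    have h1 := Real.exp_le_exp.mpr h
    have h2 : Real.exp (1 / 2) ≤ 1 + 1 := exp_half_le_one_add zero_le_one le_rfl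
    linarith
  have hLpos : 0 < L := by
    by_contra h
    push Not at h
    nlinarith
  have hL1 : 10000 ≤ L := by nlinarith
  have hx6 : 6 ≤ x := by
    rw [← hxL]
    linarith [Real.add_one_le_exp L]
  -- `L / 20` is small enough that `2(8r + 3) ≤ L`, where `3 ≤ exp 2` is used, and large enough that
  -- `r ≥ L / 40` gives `(1 + ε/4)^r ≥ y ^ 9`. The ninth power absorbs the factor `72` in `18(2y)²`,
  -- since `y > 2`.
  refine ⟨hx6, ⌊L / 20⌋₊, ?_, ?_⟩
  · have hr := Nat.floor_le (by positivity : 0 ≤ L / 20)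
    have h3 : (3 : ℝ) ≤ Real.exp 2 := by linarith [Real.add_one_le_exp (2 : ℝ)]
    calc (3 : ℝ) ^ (8 * ⌊L / 20⌋₊ + 3) ≤ Real.exp 2 ^ (8 * ⌊L / 20⌋₊ + 3) :=
          pow_le_pow_left₀ (by norm_num) h3 _
      _ = Real.exp (((8 * ⌊L / 20⌋₊ + 3 : ℕ) : ℝ) * 2) := by rw [← Real.exp_nat_mul]
      _ ≤ Real.exp L := by
          rw [Real.exp_le_exp]
          push_cast
          linarith
      _ = x := hxL
  · have hr := Nat.lt_floor_add_one (L / 20)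
    have hceil := Nat.ceil_lt_add_one (by linarith : 0 ≤ y)
    have hceil' : (⌈y⌉₊ : ℝ) ≤ 2 * y := by linarith
    have h1 : 18 * (⌈y⌉₊ : ℝ) ^ 2 ≤ 18 * (2 * y) ^ 2 := by
      have := pow_le_pow_left₀ (Nat.cast_nonneg _) hceil' 2
      linarith
    have h2 : (2 : ℝ) ^ 7 ≤ y ^ 7 := pow_le_pow_left₀ (by norm_num) hy.le 7
    have h3 : 18 * (2 * y) ^ 2 < y ^ 9 := by
      have : y ^ 9 = y ^ 7 * y ^ 2 := by ring
      rw [this]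
      have hy2 : 0 < y ^ 2 := by positivity
      nlinarith
    have h4 : y ^ 9 ≤ (1 + ε / 4) ^ ⌊L / 20⌋₊ := by
      calc y ^ 9 = Real.exp (((9 : ℕ) : ℝ) * (L * (1 / 10000 * ε))) := by
            rw [hyL, ← Real.exp_nat_mul]
        _ ≤ Real.exp ((⌊L / 20⌋₊ : ℝ) * (ε / 4 / 2)) := by
            rw [Real.exp_le_exp]
            have h5 : L / 40 * (ε / 4 / 2) ≤ (⌊L / 20⌋₊ : ℝ) * (ε / 4 / 2) :=
              mul_le_mul_of_nonneg_right (by linarith) (by positivity)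
            have h6 : 0 < L * ε := by positivity
            push_cast
            nlinarith
        _ = Real.exp (ε / 4 / 2) ^ ⌊L / 20⌋₊ := by rw [Real.exp_nat_mul]
        _ ≤ _ := pow_le_pow_left₀ (Real.exp_pos _).le
            (exp_half_le_one_add (by linarith) (by linarith)) _
    linarith

theorem clientCanBuild_hasCliqueMinor {n q : ℕ} (hn : 2 ≤ n) {ε : ℝ} (hε : 0 < ε)
    (hq : (q : ℝ) ≤ (1 / 2 - ε) * n) :
    ClientCanBuild q (completeBoard n)
      (fun E => HasCliqueMinor (graphOf E) ⌈(ε * n) ^ (1 / 10000 * ε)⌉₊) := by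
  have hn' : (2 : ℝ) ≤ n := by exact_mod_cast hn
  have hx : 0 < ε * n := by positivity
  have hε2 : ε ≤ 1 / 2 := by
    by_contra h
    push Not at h
    have : (1 / 2 - ε) * n < 0 := mul_neg_of_neg_of_pos (by linarith) (by linarith)
    linarith [(Nat.cast_nonneg q : (0 : ℝ) ≤ q)]
  -- For such a small target a single edge is enough.
  by_cases hy : (ε * n) ^ (1 / 10000 * ε) ≤ 2
  · obtain ⟨T, hT, hT'⟩ := clientCanBuild_hasCliqueMinor_two hn q
    exact ⟨T, hT, fun h hp hf hfree => (hT' h hp hf hfree).anti (Nat.ceil_le.mpr (by exact_mod_cast hy))⟩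
  push Not at hy
  obtain ⟨hx6, r, hr3, hrt⟩ := exists_radius hε hε2 hx hy
  have hnp : n * (2 * (1 + ε) / n) = 2 * (1 + ε) := by field_simp
  refine clientCanBuild_of_highGirth (k := 8 * r + 2) (p := 2 * (1 + ε) / n) hn (by positivity) ?_
    (fun H E hHE h => h.mono fun u v => ?_) ?_
  · rw [div_mul_eq_mul_div, div_le_one (by positivity)]
    have : 2 * (1 + ε) * (q + 1) ≤ 2 * (1 + ε) * ((1 / 2 - ε) * n + 1) :=
      mul_le_mul_of_nonneg_left (by linarith) (by linarith)
    nlinarith [mul_pos hε hx]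
  · simp only [graphOf, SimpleGraph.fromEdgeSet_adj, Finset.mem_coe]
    exact fun h => ⟨hHE h.1, h.2⟩
  · intro H hH hcard hgirth
    have : Nonempty (Fin n) := ⟨⟨0, by omega⟩⟩
    have hboard : ((completeBoard n).card : ℝ) = n * (n - 1) / 2 := by
      rw [completeBoard, SimpleGraph.card_edgeFinset_top_eq_card_choose_two, Fintype.card_fin,
        Nat.cast_choose_two]
    have hsum := sum_Icc_pow_le (a := 2 * (1 + ε)) (by positivity) (by linarith) (8 * r + 2)
    rw [hnp, hboard] at hcard
    have hexp : 2 * (1 + ε) / n * ((n : ℝ) * (n - 1) / 2) = (1 + ε) * (n - 1) := by field_simp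
    rw [hexp] at hcard
    refine hgirth.hasCliqueMinor (δ := ε / 4) (by positivity) le_rfl ?_ ?_ hrt
    · have h2 : (2 : ℝ) * H.card ≤ (adjPairs (graphOf H) Finset.univ).card := by
        exact_mod_cast two_mul_card_le_card_adjPairs hH
      rw [Fintype.card_fin]
      -- The surviving edges number at least `(1 + ε)(n - 1) - εn/2`. This exceeds `(1 + ε/4)n`
      -- because `εn/4 ≥ 3/2 ≥ 1 + ε`, by `hx6` and `hε2`.
      linarith
    · exact Nat.one_le_iff_ne_zero.mpr (Nat.ceil_pos.mpr (by linarith)).ne'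

end Numerics
end ClientWaiter

theorem theorem1p3 :
    ∃ c : ℝ, 0 < c ∧ ∃ n₀ : ℕ, ∀ n : ℕ, n₀ ≤ n →
      (∀ q : ℕ, (n : ℝ) / 2 - 1 ≤ (q : ℝ) →
        ClientWaiter.WaiterCanKeep q (ClientWaiter.completeBoard n)
          (fun E => ¬ ClientWaiter.HasCliqueMinor (ClientWaiter.graphOf E) 3)) ∧
      (∀ ε : ℝ, 0 < ε → ∀ q : ℕ, (q : ℝ) ≤ (1 / 2 - ε) * (n : ℝ) →
        ClientWaiter.ClientCanBuild q (ClientWaiter.completeBoard n)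
          (fun E => ClientWaiter.HasCliqueMinor (ClientWaiter.graphOf E)
            ⌈(ε * (n : ℝ)) ^ (c * ε)⌉₊)) := by
  refine ⟨1 / 10000, by norm_num, 2, fun n hn => ⟨fun q hq => ?_, fun ε hε q hq => ?_⟩⟩
  · refine ClientWaiter.waiterCanKeep_not_hasCliqueMinor_three (by omega) ?_
    have : (n : ℝ) ≤ 2 * (q + 1) := by linarith
    exact_mod_cast this
  · exact ClientWaiter.clientCanBuild_hasCliqueMinor hn hε hq
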